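/- Let $\pi$ be a probability distribution on a Polish space $\mathcal X$ and let $P$ be a $\pi$-irreducible Markov transition kernel on $\mathcal X$ with $\pi P=\pi$. Assume that there are a Borel set $J\subseteq\mathcal X$ with $\pi(J)>0$, a number $\beta>0$ and a probability measure $\nu$ such that $P(x,\cdot)\ge \beta\,\mathbf 1(x\in J)\,\nu(\cdot)$ for all $x$. Let $(X_n,\Gamma_n)_{n\ge 0}$ be the split chain on $\mathcal X\times\{0,1\}$ started from $X_0\sim\nu$: given $X_0,\dots,X_n,\Gamma_0,\dots,\Gamma_{n-1}$, we have $\Gamma_n=1$ with probability $\beta\,\mathbf 1(X_n\in J)$; given also $\Gamma_n$, the state $X_{n+1}$ is drawn from $\nu$ if $\Gamma_n=1$, and from $$Q(X_n,\cdot)=\frac{P(X_n,\cdot)-\beta\,\mathbf 1(X_n\in J)\,\nu(\cdot)}{1-\beta\,\mathbf 1(X_n\in J)}$$ if $\Gamma_n=0$. Let $T_0=0$, $T_k=\min\{m> T_{k-1}:\Gamma_{m-1}=1\}$ (with $\min\emptyset=\infty$) and $\tau_k=T_k-T_{k-1}$ for $k\ge1$, and for $g:\mathcal X\to\mathbb R$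 put $\Xi_k(g)=\sum_{i=T_{k-1}}^{T_k-1}g(X_i)$. Let $f:\mathcal X\to\mathbb R$ be Borel with $\pi(|f|)<\infty$, let $\theta=\pi(f)=\int f\,d\pi$ and $\bar f=f-\theta$, and assume $\mathbb E\,(\Xi_1(\bar f))^2<\infty$ and $\mathbb E\,\tau_1^2<\infty$. For $n\ge 1$ let $R(n)=\min\{r:T_r\ge n\}$ and $$\hat\theta_{T_{R(n)}}=\frac1{T_{R(n)}}\sum_{k=1}^{R(n)}\Xi_k(f).$$ Then, for every $n\ge1$, $T_{R(n)}$ is almost surely finite (so that $\hat\theta_{T_{R(n)}}$ is almost surely well defined), $\hat\theta_{T_{R(n)}}-\theta$ is square integrable, and $$\mathbb E\,(\hat\theta_{T_{R(n)}}-\theta)^2\le\frac{\sigma_{\rm as}^2(f)}{n}\left(1+\frac{n_0}{n}\right),\qquad \sigma_{\rm as}^2(f)=\frac{\mathbb E\,(\Xi_1(\bar f))^2}{\mathbb E\,\tau_1},\quad n_0=\frac{\mathbb E\,\tau_1^2}{\mathbb E\,\tau_1}-1 .$$ -/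

import Mathlib

open MeasureTheory ProbabilityTheory Set
open scoped ENNReal

/-- The small set (one-step minorization) condition: `J` is a measurable set of positive
`π`-measure, `β > 0`, and `P(x, ·) ≥ β 𝟙(x ∈ J) ν(·)` for all `x`. -/
structure SmallSetCondition {𝒳 : Type*} [MeasurableSpace 𝒳]
    (P : Kernel 𝒳 𝒳) (π ν : Measure 𝒳) (J : Set 𝒳) (β : ℝ) : Prop where
  measurableSet : MeasurableSet J
  pos_measure : 0 < π J
  beta_pos : 0 < β
  minorization : ∀ x ∈ J, ENNReal.ofReal β • ν ≤ P x

/-- The normalized residual kernel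
`Q(x, A) = (P(x, A) - β 𝟙(x ∈ J) ν(A)) / (1 - β 𝟙(x ∈ J))`.
(If `β = 1`, its value for `x ∈ J` is never used with positive probability.) -/
noncomputable def residualProb {𝒳 : Type*} [MeasurableSpace 𝒳]
    (P : Kernel 𝒳 𝒳) (ν : Measure 𝒳) (J : Set 𝒳) (β : ℝ) (x : 𝒳) (A : Set 𝒳) : ℝ :=
  ((P x).real A - J.indicator (fun _ => β) x * ν.real A) / (1 - J.indicator (fun _ => β) x)

/-- The σ-algebra generated by `X 0, …, X n` and `Γ 0, …, Γ (n - 1)`. -/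
abbrev historyX {Ω 𝒳 : Type*} [MeasurableSpace 𝒳] (X : ℕ → Ω → 𝒳) (Γ : ℕ → Ω → Bool) (n : ℕ) :
    MeasurableSpace Ω :=
  (⨆ i : ℕ, ⨆ _ : i ≤ n, MeasurableSpace.comap (X i) inferInstance) ⊔
    (⨆ i : ℕ, ⨆ _ : i < n, MeasurableSpace.comap (Γ i) inferInstance)

/-- The σ-algebra generated by `X 0, …, X n` and `Γ 0, …, Γ n`. -/
abbrev historyXΓ {Ω 𝒳 : Type*} [MeasurableSpace 𝒳] (X : ℕ → Ω → 𝒳) (Γ : ℕ → Ω → Bool) (n : ℕ) :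
    MeasurableSpace Ω :=
  historyX X Γ n ⊔ MeasurableSpace.comap (Γ n) inferInstance

/-- `(X n, Γ n)` is, under `μ`, the split chain of `P` with regeneration measure `ν`, started
from `X 0 ∼ ν`: given the past, `Γ n` is `true` (i.e. `1`) with probability `β 𝟙(X n ∈ J)`, and
given the past and `Γ n`, the next state `X (n + 1)` is drawn from `ν` if `Γ n` is `true` and from
`Q(X n, ·)` if `Γ n` is `false`. -/
structure IsSplitChain {Ω 𝒳 : Type*} [MeasurableSpace Ω] [MeasurableSpace 𝒳]
    (P : Kernel 𝒳 𝒳) (ν : Measure 𝒳) (J : Set 𝒳) (β : ℝ) (μ : Measure Ω)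
    (X : ℕ → Ω → 𝒳) (Γ : ℕ → Ω → Bool) : Prop where
  measurable_X : ∀ n, Measurable (X n)
  measurable_Γ : ∀ n, Measurable (Γ n)
  init : μ.map (X 0) = ν
  regeneration : ∀ n,
    μ[(Γ n ⁻¹' {true}).indicator (fun _ => (1 : ℝ)) | historyX X Γ n]
      =ᵐ[μ] fun ω => J.indicator (fun _ => β) (X n ω)
  transition : ∀ n, ∀ A, MeasurableSet A →
    μ[(X (n + 1) ⁻¹' A).indicator (fun _ => (1 : ℝ)) | historyXΓ X Γ n]
      =ᵐ[μ] fun ω => if Γ n ω = true then ν.real A else residualProb P ν J β (X n ω) A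

/-- The regeneration epochs: `T 0 = 0` and `T (k + 1) = min {m > T k : Γ (m - 1) = 1}`, with
value `⊤` if there is no such `m`. -/
noncomputable def regenTime {Ω : Type*} (Γ : ℕ → Ω → Bool) : ℕ → Ω → ℕ∞
  | 0, _ => 0
  | k + 1, ω => sInf {t : ℕ∞ | ∃ m : ℕ, t = m ∧ regenTime Γ k ω < m ∧ Γ (m - 1) ω = true}

/-- The block lengths `τ k = T k - T (k - 1)`, for `k ≥ 1`. -/
noncomputable def blockLength {Ω : Type*} (Γ : ℕ → Ω → Bool) (k : ℕ) (ω : Ω) : ℕ∞ :=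
  regenTime Γ k ω - regenTime Γ (k - 1) ω

/-- The block sums `Ξ k (g) = ∑_{i = T (k - 1)}^{T k - 1} g (X i)`, for `k ≥ 1` and `T k < ∞`. -/
noncomputable def blockSum {Ω 𝒳 : Type*} (X : ℕ → Ω → 𝒳) (Γ : ℕ → Ω → Bool) (g : 𝒳 → ℝ)
    (k : ℕ) (ω : Ω) : ℝ :=
  ∑ i ∈ Finset.Ico (regenTime Γ (k - 1) ω).toNat (regenTime Γ k ω).toNat, g (X i ω)

/-- `R(n) = min {r : T r ≥ n}` (the set is never empty, as `T r ≥ r`). -/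
noncomputable def stopIndex {Ω : Type*} (Γ : ℕ → Ω → Bool) (n : ℕ) (ω : Ω) : ℕ :=
  sInf {r : ℕ | (n : ℕ∞) ≤ regenTime Γ r ω}

/-- `T_{R(n)}`, the first regeneration epoch that is at least `n`. -/
noncomputable def stopTime {Ω : Type*} (Γ : ℕ → Ω → Bool) (n : ℕ) (ω : Ω) : ℕ∞ :=
  regenTime Γ (stopIndex Γ n ω) ω

/-- The sequential regenerative estimator `(1 / T_{R(n)}) ∑_{k = 1}^{R(n)} Ξ k (f)`. -/
noncomputable def seqRegenEstimator {Ω 𝒳 : Type*} (X : ℕ → Ω → 𝒳) (Γ : ℕ → Ω → Bool)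
    (f : 𝒳 → ℝ) (n : ℕ) (ω : Ω) : ℝ :=
  (1 / ((stopTime Γ n ω).toNat : ℝ)) *
    ∑ k ∈ Finset.Icc 1 (stopIndex Γ n ω), blockSum X Γ f k ω

/-- The moment `E τ₁ ^ p` of the first block length, as an extended nonnegative real. -/
noncomputable def blockMoment {Ω : Type*} [MeasurableSpace Ω] (μ : Measure Ω)
    (Γ : ℕ → Ω → Bool) (p : ℕ) : ℝ≥0∞ :=
  ∫⁻ ω, ((blockLength Γ 1 ω : ℕ∞) : ℝ≥0∞) ^ p ∂μ

/-- The centred function `f - π(f)`. -/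
noncomputable def centred {𝒳 : Type*} [MeasurableSpace 𝒳] (π : Measure 𝒳) (f : 𝒳 → ℝ) (x : 𝒳) :
    ℝ :=
  f x - ∫ y, f y ∂π

/-- The asymptotic variance `σ²_as(f) = E (Ξ₁(f - π(f)))² / E τ₁`. -/
noncomputable def asymptoticVariance {Ω 𝒳 : Type*} [MeasurableSpace Ω] [MeasurableSpace 𝒳]
    (π : Measure 𝒳) (μ : Measure Ω) (X : ℕ → Ω → 𝒳) (Γ : ℕ → Ω → Bool) (f : 𝒳 → ℝ) : ℝ :=
  (∫ ω, (blockSum X Γ (centred π f) 1 ω) ^ 2 ∂μ) / (blockMoment μ Γ 1).toReal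

/-- The overshoot constant `n₀ = E τ₁² / E τ₁ - 1`. -/
noncomputable def overshootConst {Ω : Type*} [MeasurableSpace Ω] (μ : Measure Ω)
    (Γ : ℕ → Ω → Bool) : ℝ :=
  (blockMoment μ Γ 2).toReal / (blockMoment μ Γ 1).toReal - 1

/-! Index the blocks by their starting times rather than by their numbers. The sum of `f - θ` up to
`T_{R(n)}` is then a sum `S` over the fixed range `i < n` of blocks, each switched on by the event
that a block starts at `i`. The estimation error is `S / T_{R(n)}` with `T_{R(n)} ≥ n`
(`seqRegenEstimator_sub`), so the mean square error is at most `E S² / n²`. Three facts bound this;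
write `u i` for the probability that a block starts at `i`.

Regeneration (`measure_inter_renewal`): from a renewal on, the path is independent of the strict
past and distributed as the whole path. Hence the block at `i` has second moment `u i * E Ξ₁²`, and
distinct blocks are orthogonal once `E Ξ₁ = 0`, so `E S² = (∑_{i < n} u i) E Ξ₁²`
(`integral_sum_renewalBlock_sq`).

Kac's formula (`stationary_eq_smul_occupation`): `π` is a multiple of the expected occupation
measure of the first block. Comparing total masses gives `E τ₁ < ∞`, hence infinitely many
regenerations almost surely; integrating `f - θ` gives `E Ξ₁ = 0`.

Lorden's inequality (`renewal_lorden`): `E τ₁ * ∑_{i < n} u i ≤ n + n₀`. The mean residual life `v`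
satisfies `m U(t) = t + v(t)`, with `m = E τ₁` and `U` the partial sums of `u`. Subadditivity of `U`
bounds `v(t)` by averages of earlier values, a second-order renewal identity evaluates their sum,
and `(E V)² ≤ E V²` for the residual life `V` closes the estimate. -/

/-! ### Lorden's inequality for discrete renewal sequences -/

/-- The convolution `∑_{k ≤ t} u k * h (t - k)` of two sequences. -/
noncomputable def seqConv (u h : ℕ → ℝ) (t : ℕ) : ℝ :=
  ∑ k ∈ Finset.range (t + 1), u k * h (t - k)

lemma seqConv_succ {u h g : ℕ → ℝ} (hg : ∀ k, h k = h (k + 1) + g k) (t : ℕ) :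
    seqConv u h (t + 1) = seqConv u h t - seqConv u g t + u (t + 1) * h 0 := by
  unfold seqConv
  rw [Finset.sum_range_succ, ← Finset.sum_sub_distrib]
  congr 1
  · refine Finset.sum_congr rfl fun k hk => ?_
    have hk' : k ≤ t := by simpa [Nat.lt_succ_iff] using hk
    rw [hg (t - k), show t + 1 - k = t - k + 1 by omega]
    ring
  · simp

/-- Summation by parts: the increments of the convolution with `h` telescope. Taking `h` to be an
iterated tail sum of `q` turns the renewal equation into identities for the moments of the residual
life. -/
lemma seqConv_add_sum {u h g : ℕ → ℝ} (hg : ∀ k, h k = h (k + 1) + g k) (t : ℕ) :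
    seqConv u h t + ∑ s ∈ Finset.range t, seqConv u g s =
      h 0 * ∑ k ∈ Finset.range (t + 1), u k := by
  induction t with
  | zero => simp [seqConv, mul_comm]
  | succ t ih =>
    rw [seqConv_succ hg, Finset.sum_range_succ, Finset.sum_range_succ _ (t + 1), mul_add, ← ih]
    ring

lemma seqConv_tsum {u : ℕ → ℝ} {F : ℕ → ℕ → ℝ} (hF : ∀ k, Summable (F k)) (t : ℕ) :
    HasSum (fun j => seqConv u (fun k => F k j) t) (seqConv u (fun k => ∑' j, F k j) t) :=
  hasSum_sum fun k _ => (hF (t - k)).hasSum.mul_left (u k)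

/-- The discrete second-moment inequality `(∑ a)² ≤ ∑ (2 j + 1) a j` for sequences in `[0, 1]`
that decrease; it is `(E V)² ≤ E V²` with `a j = P(V > j)`. -/
lemma sq_sum_le_of_le_one {a : ℕ → ℝ} (h0 : ∀ j, 0 ≤ a j) (h1 : ∀ j, a j ≤ 1) (N : ℕ) :
    (∑ j ∈ Finset.range N, a j) ^ 2 ≤ ∑ j ∈ Finset.range N, (2 * (j : ℝ) + 1) * a j := by
  induction N with
  | zero => simp
  | succ N ih =>
    rw [Finset.sum_range_succ, Finset.sum_range_succ]
    have hA : ∑ j ∈ Finset.range N, a j ≤ N := by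
      simpa using Finset.sum_le_sum (s := Finset.range N) fun j _ => h1 j
    -- The square grows by `2 A a + a²`, where `A ≤ N` and `a² ≤ a`.
    nlinarith [mul_le_mul_of_nonneg_right hA (h0 N), mul_le_mul_of_nonneg_left (h1 N) (h0 N)]

/-- Lorden's inequality for a discrete renewal sequence `u` whose interarrival time has tail
`q k = P(τ > k)`. -/
theorem renewal_lorden {u q : ℕ → ℝ} (hu0 : u 0 = 1) (hu : ∀ n, 0 ≤ u n) (hq : ∀ n, 0 ≤ q n)
    (hanti : Antitone q) (hren : ∀ n, seqConv u q n = 1)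
    (hsub : ∀ s r, ∑ k ∈ Finset.range r, u (s + 1 + k) ≤ ∑ k ∈ Finset.range r, u k)
    (hsum : Summable q) (hsum' : Summable fun k : ℕ => (k : ℝ) * q k) (t : ℕ) :
    (∑' k, q k) * ∑ k ∈ Finset.range (t + 1), u k ≤
      t + 1 + 2 * (∑' k : ℕ, (k : ℝ) * q k) / ∑' k, q k := by
  have hsh : ∀ k, Summable fun j => q (k + j) := fun k => by
    simpa [add_comm] using (summable_nat_add_iff k).2 hsum
  have hsh' : ∀ k, Summable fun j : ℕ => (j : ℝ) * q (k + j) := fun k => by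
    refine Summable.of_nonneg_of_le (fun j => mul_nonneg j.cast_nonneg (hq _)) (fun j => ?_) hsum'
    exact mul_le_mul_of_nonneg_left (hanti (by omega)) j.cast_nonneg
  -- `Q k = E (τ - k)⁺` and `C k` is the mean of `(τ - k)⁺` choose 2. Convolved with `u`, they give
  -- the means of `V` and of `V (V - 1) / 2`, for the residual life `V` at time `t`.
  set Q : ℕ → ℝ := fun k => ∑' j, q (k + j) with hQ
  set C : ℕ → ℝ := fun k => ∑' j : ℕ, (j : ℝ) * q (k + j) with hC
  have hQq : ∀ k, Q k = Q (k + 1) + q k := fun k => by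
    simp only [hQ]
    rw [(hsh k).tsum_eq_zero_add, add_comm]
    simp [add_assoc, add_comm 1]
  have hCQ : ∀ k, C k = C (k + 1) + Q (k + 1) := fun k => by
    simp only [hC, hQ]
    rw [(hsh' k).tsum_eq_zero_add, ← (hsh' (k + 1)).tsum_add (hsh (k + 1))]
    simp only [Nat.cast_zero, zero_mul, zero_add]
    refine tsum_congr fun j => ?_
    rw [show k + (j + 1) = k + 1 + j by omega]
    push_cast
    ring
  set m := ∑' k, q k with hm
  set B := ∑' k : ℕ, (k : ℝ) * q k with hB
  have hQ0 : Q 0 = m := by simp [hQ, hm]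
  have hC0 : C 0 = B := by simp [hC, hB]
  have hq0 : q 0 = 1 := by simpa [seqConv, hu0] using hren 0
  have hm1 : 1 ≤ m := by
    simpa [hq0] using hsum.le_tsum 0 fun j _ => hq j
  set U : ℕ → ℝ := fun t => ∑ k ∈ Finset.range (t + 1), u k with hU
  have hv : ∀ t, seqConv u Q t + t = m * U t := fun t => by
    simpa [hren, hQ0] using seqConv_add_sum hQq (u := u) t
  have hQ1 : ∀ s, seqConv u (fun k => Q (k + 1)) s = seqConv u Q s - 1 := fun s => by
    rw [← hren s]
    simp only [seqConv, ← Finset.sum_sub_distrib]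
    refine Finset.sum_congr rfl fun k _ => ?_
    rw [hQq (s - k)]
    ring
  have hc : seqConv u C t + ∑ s ∈ Finset.range t, seqConv u Q s - t = B * U t := by
    have := seqConv_add_sum hCQ (u := u) t
    simp only [hQ1, hC0, Finset.sum_sub_distrib] at this
    simp at this
    linarith
  have hsubU : ∀ s < t, U t ≤ U s + U (t - 1 - s) := fun s hs => by
    have h := hsub s (t - s)
    simp only [hU]
    rw [show t + 1 = s + 1 + (t - s) by omega, Finset.sum_range_add,
      show t - 1 - s + 1 = t - s by omega]
    linarith
  -- Substituting `m U(t) = v(t) + t` into subadditivity; the times `s` and `t - 1 - s` add up to `t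
  -- - 1`, which leaves the `+ 1`.
  have hvsub : ∀ s ∈ Finset.range t,
      seqConv u Q t + 1 ≤ seqConv u Q s + seqConv u Q (t - 1 - s) := fun s hs => by
    have hs' : s < t := by simpa using hs
    have h := mul_le_mul_of_nonneg_left (hsubU s hs') (by linarith : (0 : ℝ) ≤ m)
    rw [mul_add, ← hv, ← hv, ← hv] at h
    have : ((t - 1 - s : ℕ) : ℝ) = t - 1 - s := by
      rw [Nat.cast_sub (by omega), Nat.cast_sub (by omega)]
      simp
    linarith
  have h1 : t * (seqConv u Q t + 1) ≤ 2 * ∑ s ∈ Finset.range t, seqConv u Q s := by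
    have := Finset.sum_le_sum hvsub
    rw [Finset.sum_add_distrib, Finset.sum_add_distrib,
      Finset.sum_range_reflect (fun s => seqConv u Q s) t] at this
    simp only [Finset.sum_const, Finset.card_range, nsmul_eq_mul] at this
    linarith
  -- This is `(E V)² ≤ E V²` with `a j = P(V > j)`; the bound `a j ≤ 1` is the renewal equation
  -- together with monotonicity of `q`.
  have h2 : seqConv u Q t ^ 2 ≤ 2 * seqConv u C t + seqConv u Q t := by
    set a : ℕ → ℝ := fun j => seqConv u (fun k => q (k + j)) t with ha
    have ha0 : ∀ j, 0 ≤ a j := fun j => Finset.sum_nonneg fun k _ => mul_nonneg (hu _) (hq _)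
    have ha1 : ∀ j, a j ≤ 1 := fun j => by
      rw [← hren t]
      exact Finset.sum_le_sum fun k _ =>
        mul_le_mul_of_nonneg_left (hanti (Nat.le_add_right _ _)) (hu _)
    have hs1 : HasSum a (seqConv u Q t) := seqConv_tsum hsh t
    have hs2 : HasSum (fun j : ℕ => (j : ℝ) * a j) (seqConv u C t) := by
      convert seqConv_tsum (u := u) hsh' t using 2 with j
      simp only [ha, seqConv, Finset.mul_sum]
      exact Finset.sum_congr rfl fun k _ => by ring
    have hs3 : HasSum (fun j : ℕ => (2 * (j : ℝ) + 1) * a j)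
        (2 * seqConv u C t + seqConv u Q t) := by
      simpa only [add_mul, one_mul, mul_assoc] using (hs2.mul_left 2).add hs1
    exact le_of_tendsto_of_tendsto' (hs1.tendsto_sum_nat.pow 2) hs3.tendsto_sum_nat
      (sq_sum_le_of_le_one ha0 ha1)
  have hU1 : 1 ≤ U t := by
    have := Finset.single_le_sum (f := u) (fun i _ => hu i)
      (Finset.mem_range.2 (Nat.succ_pos t))
    simpa [hu0] using this
  have hmU := hv t
  have hpos : 0 < m * U t := by positivity
  -- Eliminating `∑ v(s)` and `seqConv u C t` from `hc`, `h1` and `h2` leaves a quadratic that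
  -- factors as `(v + t)(v - 1) ≤ 2 B U`, and `v + t = m U`.
  have key : (m * U t) * (seqConv u Q t - 1) ≤ 2 * B * U t := by
    rw [← hmU]
    nlinarith
  have : seqConv u Q t - 1 ≤ 2 * B / m := by
    rw [le_div_iff₀ (by linarith)]
    have hUpos : 0 < U t := by linarith
    nlinarith
  change m * U t ≤ _
  rw [← hmU]
  linarith

/-! ### The filtration of the split chain -/

section History

variable {Ω 𝒳 : Type*} [MeasurableSpace 𝒳]

namespace IsSplitChain

lemma measurable_X_historyX (X : ℕ → Ω → 𝒳) (Γ : ℕ → Ω → Bool) {i n : ℕ} (h : i ≤ n) :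
    Measurable[historyX X Γ n] (X i) :=
  Measurable.of_comap_le (le_sup_of_le_left (le_iSup₂_of_le i h le_rfl))

lemma measurable_Γ_historyX (X : ℕ → Ω → 𝒳) (Γ : ℕ → Ω → Bool) {i n : ℕ} (h : i < n) :
    Measurable[historyX X Γ n] (Γ i) :=
  Measurable.of_comap_le (le_sup_of_le_right (le_iSup₂_of_le i h le_rfl))

lemma measurable_X_historyXΓ (X : ℕ → Ω → 𝒳) (Γ : ℕ → Ω → Bool) {i n : ℕ} (h : i ≤ n) :
    Measurable[historyXΓ X Γ n] (X i) :=
  (measurable_X_historyX X Γ h).mono le_sup_left le_rfl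

lemma measurable_Γ_historyXΓ (X : ℕ → Ω → 𝒳) (Γ : ℕ → Ω → Bool) {i n : ℕ} (h : i ≤ n) :
    Measurable[historyXΓ X Γ n] (Γ i) := by
  rcases h.lt_or_eq with h | rfl
  · exact (measurable_Γ_historyX X Γ h).mono le_sup_left le_rfl
  · exact Measurable.of_comap_le le_sup_right

lemma historyXΓ_le_historyX_succ (X : ℕ → Ω → 𝒳) (Γ : ℕ → Ω → Bool) (n : ℕ) :
    historyXΓ X Γ n ≤ historyX X Γ (n + 1) := by
  refine sup_le (sup_le ?_ ?_) ?_
  · exact iSup₂_le fun i hi => (measurable_X_historyX X Γ (by omega)).comap_le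
  · exact iSup₂_le fun i hi => (measurable_Γ_historyX X Γ (by omega)).comap_le
  · exact (measurable_Γ_historyX X Γ (by omega)).comap_le

lemma historyXΓ_mono (X : ℕ → Ω → 𝒳) (Γ : ℕ → Ω → Bool) {m n : ℕ} (h : m ≤ n) :
    historyXΓ X Γ m ≤ historyXΓ X Γ n :=
  sup_le (sup_le
    (iSup₂_le fun i hi => le_sup_of_le_left (le_sup_of_le_left
      (le_iSup₂_of_le i (hi.trans h) le_rfl)))
    (iSup₂_le fun i hi => le_sup_of_le_left (le_sup_of_le_right
      (le_iSup₂_of_le i (hi.trans_le h) le_rfl))))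
    (measurable_Γ_historyXΓ X Γ h).comap_le

end IsSplitChain

end History

/-! ### One-step laws of the split chain -/

section SplitChain

variable {Ω 𝒳 : Type*} [MeasurableSpace Ω] [MeasurableSpace 𝒳]

/-- The path of the split chain from time `m` on. -/
def pathFrom (X : ℕ → Ω → 𝒳) (Γ : ℕ → Ω → Bool) (m : ℕ) (ω : Ω) : ℕ → 𝒳 × Bool :=
  fun k => (X (m + k) ω, Γ (m + k) ω)

/-- The event that a block starts at time `i`. -/
def renewalSet (Γ : ℕ → Ω → Bool) : ℕ → Set Ω
  | 0 => univ
  | i + 1 => Γ i ⁻¹' {true}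

/-- The σ-algebra of the history strictly before time `i`. -/
abbrev strictHistory (X : ℕ → Ω → 𝒳) (Γ : ℕ → Ω → Bool) : ℕ → MeasurableSpace Ω
  | 0 => ⊥
  | i + 1 => historyXΓ X Γ i

/-- The probability that the next state is in `A`, given the current value of the split chain. -/
noncomputable def stepProb (P : Kernel 𝒳 𝒳) (ν : Measure 𝒳) (J : Set 𝒳) (β : ℝ) (A : Set 𝒳)
    (y : 𝒳 × Bool) : ℝ :=
  if y.2 = true then ν.real A else residualProb P ν J β y.1 A

lemma measurable_residualProb {P : Kernel 𝒳 𝒳} {ν : Measure 𝒳} {J : Set 𝒳} {β : ℝ} {A : Set 𝒳}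
    (hJ : MeasurableSet J) (hA : MeasurableSet A) :
    Measurable fun x => residualProb P ν J β x A :=
  have hI : Measurable (J.indicator fun _ : 𝒳 => β) := measurable_const.indicator hJ
  ((Kernel.measurable_coe P hA).ennreal_toReal.sub (hI.mul_const _)).div (measurable_const.sub hI)

lemma measurable_stepProb {P : Kernel 𝒳 𝒳} {ν : Measure 𝒳} {J : Set 𝒳} {β : ℝ} {A : Set 𝒳}
    (hJ : MeasurableSet J) (hA : MeasurableSet A) : Measurable (stepProb P ν J β A) := by
  have hR : Measurable fun x => residualProb P ν J β x A := measurable_residualProb hJ hA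
  exact Measurable.ite (measurable_snd (measurableSet_singleton true)) measurable_const
    (hR.comp measurable_fst)

/-- The mass over `false` is the first marginal minus the mass over `true`; finiteness allows the
subtraction. These two families are what the transition and regeneration rules provide. -/
lemma Measure.ext_prod_bool {ρ₁ ρ₂ : Measure (𝒳 × Bool)} [IsFiniteMeasure ρ₁]
    [IsFiniteMeasure ρ₂]
    (h₁ : ∀ A, MeasurableSet A → ρ₁.real (Prod.fst ⁻¹' A) = ρ₂.real (Prod.fst ⁻¹' A))
    (h₂ : ∀ A, MeasurableSet A → ρ₁.real (A ×ˢ {true}) = ρ₂.real (A ×ˢ {true})) :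
    ρ₁ = ρ₂ := by
  have hfst : ∀ ρ : Measure (𝒳 × Bool), IsFiniteMeasure ρ → ∀ A, MeasurableSet A →
      ρ.real (Prod.fst ⁻¹' A) = ρ.real (A ×ˢ {true}) + ρ.real (A ×ˢ {false}) := by
    intro ρ _ A hA
    rw [← measureReal_union _ (hA.prod (measurableSet_singleton false))]
    · congr 1
      ext ⟨x, b⟩
      cases b <;> simp
    · exact Set.disjoint_left.2 fun y h h' => absurd (h.2.symm.trans h'.2) (by simp)
  have h₃ : ∀ A, MeasurableSet A → ρ₁.real (A ×ˢ {false}) = ρ₂.real (A ×ˢ {false}) := by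
    intro A hA
    have := h₁ A hA
    rw [hfst ρ₁ inferInstance A hA, hfst ρ₂ inferInstance A hA, h₂ A hA] at this
    linarith
  ext S hS
  have hSt : MeasurableSet {x : 𝒳 | (x, true) ∈ S} := measurable_prodMk_right hS
  have hSf : MeasurableSet {x : 𝒳 | (x, false) ∈ S} := measurable_prodMk_right hS
  have hdec : S = {x | (x, true) ∈ S} ×ˢ {true} ∪ {x | (x, false) ∈ S} ×ˢ {false} := by
    ext ⟨x, b⟩
    cases b <;> simp
  rw [← measureReal_eq_measureReal_iff, hdec, measureReal_union, measureReal_union, h₂ _ hSt,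
    h₃ _ hSf]
  all_goals first
    | exact hSf.prod (measurableSet_singleton false)
    | exact Set.disjoint_left.2 fun y h h' => absurd (h.2.symm.trans h'.2) (by simp)

variable {P : Kernel 𝒳 𝒳} {ν : Measure 𝒳} {J : Set 𝒳} {β : ℝ} {μ : Measure Ω}
  {X : ℕ → Ω → 𝒳} {Γ : ℕ → Ω → Bool}

namespace IsSplitChain

variable (hc : IsSplitChain P ν J β μ X Γ)
include hc

lemma historyX_le (n : ℕ) : historyX X Γ n ≤ ‹MeasurableSpace Ω› :=
  sup_le (iSup₂_le fun i _ => (hc.measurable_X i).comap_le)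
    (iSup₂_le fun i _ => (hc.measurable_Γ i).comap_le)

lemma historyXΓ_le (n : ℕ) : historyXΓ X Γ n ≤ ‹MeasurableSpace Ω› :=
  sup_le (hc.historyX_le n) (hc.measurable_Γ n).comap_le

lemma strictHistory_le (n : ℕ) : strictHistory X Γ n ≤ ‹MeasurableSpace Ω› := by
  cases n with
  | zero => exact bot_le
  | succ n => exact hc.historyXΓ_le n

lemma measurable_pathFrom (m : ℕ) : Measurable (pathFrom X Γ m) :=
  measurable_pi_lambda _ fun _ => (hc.measurable_X _).prodMk (hc.measurable_Γ _)

lemma measurableSet_renewalSet (n : ℕ) : MeasurableSet (renewalSet Γ n) := by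
  cases n with
  | zero => exact MeasurableSet.univ
  | succ n => exact hc.measurable_Γ n (measurableSet_singleton _)

lemma measurable_pair (n : ℕ) : Measurable fun ω => (X n ω, Γ n ω) :=
  (hc.measurable_X n).prodMk (hc.measurable_Γ n)

lemma real_map_restrict_pair (n : ℕ) (G : Set Ω) {S : Set (𝒳 × Bool)} (hS : MeasurableSet S) :
    ((μ.restrict G).map (fun ω => (X n ω, Γ n ω))).real S =
      μ.real (G ∩ (fun ω => (X n ω, Γ n ω)) ⁻¹' S) := by
  rw [measureReal_def, Measure.map_apply (hc.measurable_pair n) hS,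
    Measure.restrict_apply (hc.measurable_pair n hS), inter_comm, measureReal_def]

variable [IsProbabilityMeasure μ]

lemma real_inter_regeneration (hJ : MeasurableSet J) {n : ℕ} {G : Set Ω}
    (hG : MeasurableSet[historyX X Γ n] G) :
    μ.real (G ∩ Γ n ⁻¹' {true}) = β * μ.real (G ∩ X n ⁻¹' J) := by
  have hΓ : MeasurableSet (Γ n ⁻¹' {true}) := hc.measurable_Γ n (measurableSet_singleton _)
  have h := setIntegral_condExp (hc.historyX_le n) (μ := μ)
    (f := (Γ n ⁻¹' {true}).indicator fun _ => (1 : ℝ))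
    ((integrable_const _).indicator hΓ) hG
  rw [setIntegral_congr_ae (g := fun ω => (X n ⁻¹' J).indicator (fun _ => β) ω)
    (hc.historyX_le n _ hG) (by filter_upwards [hc.regeneration n] with ω hω _ using hω),
    setIntegral_indicator (hc.measurable_X n hJ), setIntegral_indicator hΓ] at h
  simp only [setIntegral_const, smul_eq_mul, mul_one] at h
  rw [← h, mul_comm]

lemma real_inter_transition {n : ℕ} {G : Set Ω} (hG : MeasurableSet[historyXΓ X Γ n] G)
    {A : Set 𝒳} (hA : MeasurableSet A) :
    μ.real (G ∩ X (n + 1) ⁻¹' A) = ∫ ω in G, stepProb P ν J β A (X n ω, Γ n ω) ∂μ := by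
  have hX : MeasurableSet (X (n + 1) ⁻¹' A) := hc.measurable_X _ hA
  have h := setIntegral_condExp (hc.historyXΓ_le n) (μ := μ)
    (f := (X (n + 1) ⁻¹' A).indicator fun _ => (1 : ℝ))
    ((integrable_const _).indicator hX) hG
  rw [setIntegral_congr_ae (g := fun ω => stepProb P ν J β A (X n ω, Γ n ω))
    (hc.historyXΓ_le n _ hG) (by filter_upwards [hc.transition n A hA] with ω hω _ using hω),
    setIntegral_indicator hX] at h
  simp only [setIntegral_const, smul_eq_mul, mul_one] at h
  exact h.symm

/-- The law of the split chain at time `n + 1` on an event of the past is determined by its law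
at time `n` on that event. -/
lemma map_pair_succ_eq (hJ : MeasurableSet J) {n n' : ℕ} {G G' : Set Ω}
    (hG : MeasurableSet[historyXΓ X Γ n] G) (hG' : MeasurableSet[historyXΓ X Γ n'] G')
    {c : ℝ≥0∞} (hc' : c ≠ ∞)
    (h : (μ.restrict G).map (fun ω => (X n ω, Γ n ω)) =
      c • (μ.restrict G').map (fun ω => (X n' ω, Γ n' ω))) :
    (μ.restrict G).map (fun ω => (X (n + 1) ω, Γ (n + 1) ω)) =
      c • (μ.restrict G').map (fun ω => (X (n' + 1) ω, Γ (n' + 1) ω)) := by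
  have hX : ∀ (n : ℕ) (G : Set Ω), MeasurableSet[historyXΓ X Γ n] G → ∀ A, MeasurableSet A →
      μ.real (G ∩ X (n + 1) ⁻¹' A) =
        ∫ y, stepProb P ν J β A y ∂(μ.restrict G).map (fun ω => (X n ω, Γ n ω)) := by
    intro n G hG A hA
    rw [hc.real_inter_transition hG hA, integral_map (hc.measurable_pair n).aemeasurable
      (measurable_stepProb hJ hA).aestronglyMeasurable]
  have hXc : ∀ A, MeasurableSet A →
      μ.real (G ∩ X (n + 1) ⁻¹' A) = c.toReal * μ.real (G' ∩ X (n' + 1) ⁻¹' A) := by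
    intro A hA
    rw [hX n G hG A hA, hX n' G' hG' A hA, h, integral_smul_measure, smul_eq_mul]
  have hreg : ∀ (n : ℕ) (G : Set Ω), MeasurableSet[historyXΓ X Γ n] G → ∀ A, MeasurableSet A →
      μ.real (G ∩ (fun ω => (X (n + 1) ω, Γ (n + 1) ω)) ⁻¹' (A ×ˢ {true})) =
        β * μ.real (G ∩ X (n + 1) ⁻¹' (A ∩ J)) := by
    intro n G hG A hA
    have := hc.real_inter_regeneration hJ (n := n + 1) (G := G ∩ X (n + 1) ⁻¹' A)
      ((historyXΓ_le_historyX_succ X Γ n _ hG).inter (measurable_X_historyX X Γ le_rfl hA))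
    rw [inter_assoc, inter_assoc] at this
    exact this
  have := Measure.smul_finite ((μ.restrict G').map (fun ω => (X (n' + 1) ω, Γ (n' + 1) ω))) hc'
  -- The first marginal comes from the transition rule; given it, the mass over `true` is `β` times
  -- the marginal on `A ∩ J`.
  refine Measure.ext_prod_bool (fun A hA => ?_) (fun A hA => ?_)
  · rw [measureReal_ennreal_smul_apply, hc.real_map_restrict_pair _ _ (measurable_fst hA),
      hc.real_map_restrict_pair _ _ (measurable_fst hA)]
    exact hXc A hA
  · rw [measureReal_ennreal_smul_apply, hc.real_map_restrict_pair _ _ (hA.prod (measurableSet_singleton _)),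
      hc.real_map_restrict_pair _ _ (hA.prod (measurableSet_singleton _)), hreg n G hG A hA, hreg n' G' hG' A hA,
      hXc _ (hA.inter hJ)]
    ring

end IsSplitChain
end SplitChain

/-! ### The regeneration property -/

section Regeneration

variable {Ω 𝒳 : Type*}

/-- The event that the split chain is in `B k` at time `m + k`, for all `k < N`. -/
def pathBox (X : ℕ → Ω → 𝒳) (Γ : ℕ → Ω → Bool) (B : ℕ → Set (𝒳 × Bool)) (m N : ℕ) : Set Ω :=
  {ω | ∀ k < N, (X (m + k) ω, Γ (m + k) ω) ∈ B k}

lemma pathBox_succ (X : ℕ → Ω → 𝒳) (Γ : ℕ → Ω → Bool) (B : ℕ → Set (𝒳 × Bool)) (m N : ℕ) :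
    pathBox X Γ B m (N + 1) =
      pathBox X Γ B m N ∩ (fun ω => (X (m + N) ω, Γ (m + N) ω)) ⁻¹' B N := by
  ext ω
  exact Nat.forall_lt_succ_right

lemma measurableSet_pathBox [MeasurableSpace 𝒳] {X : ℕ → Ω → 𝒳} {Γ : ℕ → Ω → Bool}
    {B : ℕ → Set (𝒳 × Bool)} (hB : ∀ k, MeasurableSet (B k))
    {m N n : ℕ} (h : m + N ≤ n + 1) : MeasurableSet[historyXΓ X Γ n] (pathBox X Γ B m N) := by
  have : pathBox X Γ B m N =
      ⋂ k, ⋂ (_ : k < N), (fun ω => (X (m + k) ω, Γ (m + k) ω)) ⁻¹' B k := by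
    ext ω
    simp [pathBox]
  rw [this]
  refine MeasurableSet.iInter fun k => MeasurableSet.iInter fun hk => ?_
  exact ((IsSplitChain.measurable_X_historyXΓ X Γ (by omega)).prodMk
    (IsSplitChain.measurable_Γ_historyXΓ X Γ (by omega))) (hB k)

variable [MeasurableSpace Ω] [MeasurableSpace 𝒳] {P : Kernel 𝒳 𝒳} {ν : Measure 𝒳} {J : Set 𝒳} {β : ℝ} {μ : Measure Ω}
  {X : ℕ → Ω → 𝒳} {Γ : ℕ → Ω → Bool}

namespace IsSplitChain

variable (hc : IsSplitChain P ν J β μ X Γ)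
include hc

variable [IsProbabilityMeasure μ]

lemma map_pair_regeneration (hJ : MeasurableSet J) {m : ℕ} {H : Set Ω}
    (hH : MeasurableSet[historyXΓ X Γ m] H) (hHΓ : H ⊆ Γ m ⁻¹' {true}) :
    (μ.restrict H).map (fun ω => (X (m + 1) ω, Γ (m + 1) ω)) =
      μ H • (μ.restrict univ).map (fun ω => (X 0 ω, Γ 0 ω)) := by
  have h0 : ∀ A, MeasurableSet A → μ.real (X 0 ⁻¹' A) = ν.real A := fun A hA => by
    rw [← hc.init, measureReal_def, measureReal_def, Measure.map_apply (hc.measurable_X 0) hA]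
  have h1 : ∀ A, MeasurableSet A → μ.real (H ∩ X (m + 1) ⁻¹' A) = μ.real H * ν.real A := by
    intro A hA
    rw [hc.real_inter_transition hH hA,
      setIntegral_congr_fun (f := fun ω => stepProb P ν J β A (X m ω, Γ m ω))
        (g := fun _ => ν.real A) (hc.historyXΓ_le m _ hH)
        (fun ω hω => if_pos (show Γ m ω = true from hHΓ hω))]
    simp
  have := Measure.smul_finite ((μ.restrict univ).map (fun ω => (X 0 ω, Γ 0 ω)))
    (measure_ne_top μ H)
  refine Measure.ext_prod_bool (fun A hA => ?_) (fun A hA => ?_)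
  · rw [measureReal_ennreal_smul_apply, hc.real_map_restrict_pair _ _ (measurable_fst hA),
      hc.real_map_restrict_pair _ _ (measurable_fst hA), univ_inter]
    exact (h1 A hA).trans (by rw [← h0 A hA]; rfl)
  · rw [measureReal_ennreal_smul_apply, hc.real_map_restrict_pair _ _ (hA.prod (measurableSet_singleton _)),
      hc.real_map_restrict_pair _ _ (hA.prod (measurableSet_singleton _)), univ_inter]
    have e1 := hc.real_inter_regeneration hJ (n := m + 1) (G := H ∩ X (m + 1) ⁻¹' A)
      ((historyXΓ_le_historyX_succ X Γ m _ hH).inter (measurable_X_historyX X Γ le_rfl hA))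
    have e2 := hc.real_inter_regeneration hJ (n := 0) (G := X 0 ⁻¹' A)
      (measurable_X_historyX X Γ le_rfl hA)
    rw [inter_assoc, inter_assoc, ← preimage_inter, h1 _ (hA.inter hJ)] at e1
    rw [← preimage_inter, h0 _ (hA.inter hJ)] at e2
    refine e1.trans ?_
    change _ = _ * μ.real (X 0 ⁻¹' A ∩ Γ 0 ⁻¹' {true})
    rw [e2, measureReal_def]
    ring

/-- Base case: on `H` the next state is drawn from `ν`, as at time `0`. Afterwards both sides evolve
by the same one-step rule, so proportionality with the constant `μ H` persists. -/
lemma map_pair_pathBox (hJ : MeasurableSet J) {m : ℕ} {H : Set Ω}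
    (hH : MeasurableSet[historyXΓ X Γ m] H) (hHΓ : H ⊆ Γ m ⁻¹' {true})
    {B : ℕ → Set (𝒳 × Bool)} (hB : ∀ k, MeasurableSet (B k)) (N : ℕ) :
    (μ.restrict (H ∩ pathBox X Γ B (m + 1) N)).map
        (fun ω => (X (m + 1 + N) ω, Γ (m + 1 + N) ω)) =
      μ H • (μ.restrict (pathBox X Γ B 0 N)).map (fun ω => (X (0 + N) ω, Γ (0 + N) ω)) := by
  induction N with
  | zero =>
    have h0 : ∀ m, pathBox X Γ B m 0 = univ := fun m => eq_univ_of_forall fun _ _ h => by omega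
    simpa only [h0, inter_univ, add_zero] using hc.map_pair_regeneration hJ hH hHΓ
  | succ N ih =>
    have hres : ∀ (n : ℕ) (G : Set Ω), ((μ.restrict G).map
        (fun ω => (X n ω, Γ n ω))).restrict (B N) =
          (μ.restrict (G ∩ (fun ω => (X n ω, Γ n ω)) ⁻¹' B N)).map
            (fun ω => (X n ω, Γ n ω)) := fun n G => by
      rw [Measure.restrict_map (hc.measurable_pair n) (hB N),
        Measure.restrict_restrict (hc.measurable_pair n (hB N)), inter_comm]
    -- Restricting both laws to `B N` imposes one more coordinate of the box, before the chain moves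
    -- one step.
    have h := congrArg (fun ρ => ρ.restrict (B N)) ih
    simp only [Measure.restrict_smul] at h
    rw [hres, hres, inter_assoc, ← pathBox_succ, ← pathBox_succ] at h
    refine hc.map_pair_succ_eq hJ (n := m + 1 + N) (n' := 0 + N) ?_ ?_ (measure_ne_top μ H) h
    · refine MeasurableSet.inter ?_ (measurableSet_pathBox hB (by omega))
      exact (historyXΓ_mono X Γ (by omega : m ≤ m + 1 + N)) _ hH
    · exact measurableSet_pathBox hB (by omega)

/-- The regeneration property: on an event of the past on which the chain regenerates, the law of
the future is that of the split chain started from `ν`. -/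
theorem map_pathFrom_regeneration (hJ : MeasurableSet J) {m : ℕ} {H : Set Ω}
    (hH : MeasurableSet[historyXΓ X Γ m] H) (hHΓ : H ⊆ Γ m ⁻¹' {true}) :
    (μ.restrict H).map (pathFrom X Γ (m + 1)) = μ H • μ.map (pathFrom X Γ 0) := by
  have hbox : ∀ (B : ℕ → Set (𝒳 × Bool)), (∀ k, MeasurableSet (B k)) → ∀ N,
      μ (H ∩ pathBox X Γ B (m + 1) N) = μ H * μ (pathBox X Γ B 0 N) := fun B hB N => by
    have h := congrArg (fun ρ => ρ univ) (hc.map_pair_pathBox hJ hH hHΓ hB N)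
    simpa [Measure.map_apply (hc.measurable_pair _)] using h
  refine ext_of_generate_finite _ generateFrom_squareCylinders.symm
    (isPiSystem_squareCylinders (fun _ => MeasurableSpace.isPiSystem_measurableSet)
      fun _ => by simp) ?_ ?_
  · rintro _ ⟨s, t, ht, rfl⟩
    classical
    -- A cylinder over the finite set `s` is a box over an initial segment of times, with `univ` at
    -- the times outside `s`.
    set B : ℕ → Set (𝒳 × Bool) := fun k => if k ∈ s then t k else univ with hBdef
    have hB : ∀ k, MeasurableSet (B k) := fun k => by
      by_cases hk : k ∈ s
      · simpa [hBdef, hk] using ht k (mem_univ k)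
      · simp [hBdef, hk]
    have hpre : ∀ m, pathFrom X Γ m ⁻¹' (s : Set ℕ).pi t = pathBox X Γ B m (s.sup id + 1) := by
      intro m
      ext ω
      constructor
      · intro h k _
        by_cases hk : k ∈ s
        · simpa [hBdef, hk, pathFrom] using h k hk
        · simp [hBdef, hk]
      · intro h k hk
        have := h k (Nat.lt_succ_of_le (Finset.le_sup (f := id) hk))
        simpa [hBdef, Finset.mem_coe.1 hk, pathFrom] using this
    have hS : MeasurableSet ((s : Set ℕ).pi t) :=
      MeasurableSet.pi s.countable_toSet fun i _ => ht i (mem_univ i)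
    rw [Measure.map_apply (hc.measurable_pathFrom _) hS,
      Measure.restrict_apply (hc.measurable_pathFrom _ hS), Measure.smul_apply,
      Measure.map_apply (hc.measurable_pathFrom _) hS, hpre, hpre, inter_comm, hbox B hB,
      smul_eq_mul]
  · simp [Measure.map_apply (hc.measurable_pathFrom _)]

/-- The regeneration property at a renewal: the history strictly before the start of a block is
independent of the path from then on, which is distributed as the path from time `0` on. -/
theorem measure_inter_renewal (hJ : MeasurableSet J) {i : ℕ} {A : Set Ω}
    (hA : MeasurableSet[strictHistory X Γ i] A) {S : Set (ℕ → 𝒳 × Bool)} (hS : MeasurableSet S) :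
    μ (A ∩ renewalSet Γ i ∩ pathFrom X Γ i ⁻¹' S) =
      μ (A ∩ renewalSet Γ i) * μ (pathFrom X Γ 0 ⁻¹' S) := by
  cases i with
  | zero =>
    rcases MeasurableSpace.measurableSet_bot_iff.1 hA with rfl | rfl <;> simp [renewalSet]
  | succ m =>
    have h := congrArg (fun ρ => ρ S) (hc.map_pathFrom_regeneration hJ (m := m)
      (H := A ∩ renewalSet Γ (m + 1))
      (MeasurableSet.inter hA (measurable_Γ_historyXΓ X Γ le_rfl (measurableSet_singleton _)))
      inter_subset_right)
    simp only [Measure.smul_apply, smul_eq_mul] at h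
    rwa [Measure.map_apply (hc.measurable_pathFrom _) hS,
      Measure.restrict_apply (hc.measurable_pathFrom _ hS),
      Measure.map_apply (hc.measurable_pathFrom _) hS, inter_comm] at h

end IsSplitChain
end Regeneration

/-! ### Renewal equation and subadditivity of the renewal function -/

section RenewalSequence

variable {Ω 𝒳 : Type*}

/-- The event that there is no regeneration at the `k` times from `m` on. -/
def noRegen (Γ : ℕ → Ω → Bool) (m k : ℕ) : Set Ω :=
  {ω | ∀ j < k, Γ (m + j) ω = false}

lemma preimage_pathFrom_noRegen (X : ℕ → Ω → 𝒳) (Γ : ℕ → Ω → Bool) (m k : ℕ) :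
    pathFrom X Γ m ⁻¹' noRegen (fun n (z : ℕ → 𝒳 × Bool) => (z n).2) 0 k = noRegen Γ m k := by
  ext ω
  simp [noRegen, pathFrom]

/-- A path always counts its own time `0` as a renewal, so for `k = 0` the identity needs the
intersection with `renewalSet Γ m`. -/
lemma renewalSet_inter_preimage_pathFrom (X : ℕ → Ω → 𝒳) (Γ : ℕ → Ω → Bool) (m k : ℕ) :
    renewalSet Γ m ∩
        pathFrom X Γ m ⁻¹' renewalSet (fun n (z : ℕ → 𝒳 × Bool) => (z n).2) k =
      renewalSet Γ m ∩ renewalSet Γ (m + k) := by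
  cases k with
  | zero => simp [renewalSet]
  | succ k => rfl

lemma notMem_noRegen_of_mem_renewalSet {Γ : ℕ → Ω → Bool} {ω : Ω} {k l i : ℕ}
    (hi : ω ∈ renewalSet Γ i) (hki : k < i) (hil : i ≤ k + l) : ω ∉ noRegen Γ k l := by
  intro h
  obtain ⟨i, rfl⟩ : ∃ i', i = i' + 1 := ⟨i - 1, by omega⟩
  have := h (i - k) (by omega)
  rw [show k + (i - k) = i by omega] at this
  exact absurd (this.symm.trans (show Γ i ω = true from hi)) (by simp)

lemma noRegen_antitone (Γ : ℕ → Ω → Bool) (m : ℕ) : Antitone (noRegen Γ m) :=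
  fun _ _ h _ hω j hj => hω j (hj.trans_le h)

/-- Split according to the last renewal up to `n`, which exists since `0` is a renewal. -/
lemma iUnion_renewalSet_inter_noRegen (Γ : ℕ → Ω → Bool) (n : ℕ) :
    ⋃ k ∈ Finset.range (n + 1), renewalSet Γ k ∩ noRegen Γ k (n - k) = univ := by
  classical
  refine eq_univ_of_forall fun ω => ?_
  set k := Nat.findGreatest (fun k => ω ∈ renewalSet Γ k) n with hk
  have hkn : k ≤ n := Nat.findGreatest_le n
  refine mem_biUnion (x := k) (by simpa [Nat.lt_succ_iff] using hkn) ⟨?_, fun j hj => ?_⟩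
  · exact Nat.findGreatest_spec (P := fun k => ω ∈ renewalSet Γ k) (Nat.zero_le n) (mem_univ ω)
  · by_contra h
    have h' : ω ∈ renewalSet Γ (k + j + 1) := by simpa [renewalSet] using h
    exact Nat.findGreatest_is_greatest (P := fun k => ω ∈ renewalSet Γ k)
      (show k < k + j + 1 by omega) (by omega) h'

lemma pairwiseDisjoint_renewalSet_inter_noRegen (Γ : ℕ → Ω → Bool) (n : ℕ) :
    (Finset.range (n + 1) : Set ℕ).PairwiseDisjoint
      fun k => renewalSet Γ k ∩ noRegen Γ k (n - k) := by
  have key : ∀ k i, k < i → i ≤ n → Disjoint (renewalSet Γ k ∩ noRegen Γ k (n - k))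
      (renewalSet Γ i ∩ noRegen Γ i (n - i)) := fun k i hki hin =>
    Set.disjoint_left.2 fun ω h h' =>
      notMem_noRegen_of_mem_renewalSet h'.1 hki (by omega) h.2
  intro k hk i hi hki
  simp only [Finset.coe_range, mem_Iio] at hk hi
  rcases lt_or_gt_of_ne hki with h | h
  · exact key k i h (by omega)
  · exact (key i k h (by omega)).symm

/-- The event that the first renewal after time `s` is at time `s + 1 + l`. -/
def nextRenewalSet (Γ : ℕ → Ω → Bool) (s l : ℕ) : Set Ω :=
  noRegen Γ s l ∩ renewalSet Γ (s + 1 + l)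

lemma renewalSet_subset_iUnion_nextRenewalSet (Γ : ℕ → Ω → Bool) (s k : ℕ) :
    renewalSet Γ (s + 1 + k) ⊆
      ⋃ l ∈ Finset.range (k + 1), nextRenewalSet Γ s l ∩ renewalSet Γ (s + 1 + k) := by
  classical
  intro ω hω
  have hex : ∃ l, ω ∈ renewalSet Γ (s + 1 + l) := ⟨k, hω⟩
  refine mem_biUnion (x := Nat.find hex) ?_ ⟨⟨fun j hj => ?_, Nat.find_spec hex⟩, hω⟩
  · simpa [Nat.lt_succ_iff] using Nat.find_min' hex hω
  · by_contra h
    refine Nat.find_min hex hj ?_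
    rw [show s + 1 + j = s + j + 1 by omega]
    simpa [renewalSet] using h

lemma pairwise_disjoint_nextRenewalSet (Γ : ℕ → Ω → Bool) (s : ℕ) :
    Pairwise (Function.onFun Disjoint (nextRenewalSet Γ s)) := by
  have key : ∀ k i, k < i → Disjoint (nextRenewalSet Γ s k) (nextRenewalSet Γ s i) :=
    fun k i hki => Set.disjoint_left.2 fun ω h h' =>
      notMem_noRegen_of_mem_renewalSet h.2 (by omega) (by omega) h'.1
  intro k i hki
  rcases lt_or_gt_of_ne hki with h | h
  · exact key k i h
  · exact (key i k h).symm

lemma noRegen_succ (Γ : ℕ → Ω → Bool) (l : ℕ) :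
    noRegen Γ 0 (l + 1) = noRegen Γ 0 l \ Γ l ⁻¹' {true} := by
  ext ω
  simp only [noRegen, zero_add, mem_sdiff, mem_preimage, mem_singleton_iff, Bool.not_eq_true]
  exact Nat.forall_lt_succ_right

variable [MeasurableSpace 𝒳]

lemma measurableSet_noRegen_historyX (X : ℕ → Ω → 𝒳) {Γ : ℕ → Ω → Bool} {m k n : ℕ}
    (h : m + k ≤ n) : MeasurableSet[historyX X Γ n] (noRegen Γ m k) := by
  have : noRegen Γ m k = ⋂ j, ⋂ (_ : j < k), Γ (m + j) ⁻¹' {false} := by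
    ext ω
    simp [noRegen]
  rw [this]
  exact MeasurableSet.iInter fun j => MeasurableSet.iInter fun hj =>
    IsSplitChain.measurable_Γ_historyX X Γ (by omega) (measurableSet_singleton _)

lemma measurableSet_noRegen_strictHistory (X : ℕ → Ω → 𝒳) {Γ : ℕ → Ω → Bool} {m k n : ℕ}
    (h : m + k ≤ n) : MeasurableSet[strictHistory X Γ n] (noRegen Γ m k) := by
  cases n with
  | zero =>
    have hk : k = 0 := by omega
    have : noRegen Γ m k = univ := eq_univ_of_forall fun ω j hj => by omega
    rw [this]
    exact MeasurableSet.univ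
  | succ n =>
    have : noRegen Γ m k = ⋂ j, ⋂ (_ : j < k), Γ (m + j) ⁻¹' {false} := by
      ext ω
      simp [noRegen]
    rw [this]
    exact MeasurableSet.iInter fun j => MeasurableSet.iInter fun hj =>
      IsSplitChain.measurable_Γ_historyXΓ X Γ (by omega) (measurableSet_singleton _)

lemma measurableSet_renewalSet_strictHistory (X : ℕ → Ω → 𝒳) {Γ : ℕ → Ω → Bool} {i n : ℕ}
    (h : i ≤ n) : MeasurableSet[strictHistory X Γ n] (renewalSet Γ i) := by
  cases i with
  | zero => exact MeasurableSet.univ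
  | succ i =>
    obtain ⟨n, rfl⟩ : ∃ n', n = n' + 1 := ⟨n - 1, by omega⟩
    exact IsSplitChain.measurable_Γ_historyXΓ X Γ (by omega) (measurableSet_singleton _)

variable (𝒳) in
lemma measurableSet_path_noRegen (k : ℕ) :
    MeasurableSet (noRegen (fun n (z : ℕ → 𝒳 × Bool) => (z n).2) 0 k) := by
  have : noRegen (fun n (z : ℕ → 𝒳 × Bool) => (z n).2) 0 k =
      ⋂ j, ⋂ (_ : j < k), (fun z : ℕ → 𝒳 × Bool => (z j).2) ⁻¹' {false} := by
    ext ω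
    simp [noRegen]
  rw [this]
  exact MeasurableSet.iInter fun j => MeasurableSet.iInter fun _ =>
    (measurable_snd.comp (measurable_pi_apply j)) (measurableSet_singleton _)

variable (𝒳) in
lemma measurableSet_path_renewalSet (k : ℕ) :
    MeasurableSet (renewalSet (fun n (z : ℕ → 𝒳 × Bool) => (z n).2) k) := by
  cases k with
  | zero => exact MeasurableSet.univ
  | succ k => exact (measurable_snd.comp (measurable_pi_apply k)) (measurableSet_singleton _)

namespace IsSplitChain

variable [MeasurableSpace Ω] {P : Kernel 𝒳 𝒳} {ν : Measure 𝒳} {J : Set 𝒳} {β : ℝ}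
  {μ : Measure Ω} {X : ℕ → Ω → 𝒳} {Γ : ℕ → Ω → Bool} (hc : IsSplitChain P ν J β μ X Γ)
include hc

lemma measurableSet_noRegen (m k : ℕ) : MeasurableSet (noRegen Γ m k) :=
  hc.historyX_le _ _ (measurableSet_noRegen_historyX X (le_refl (m + k)))

lemma measurableSet_nextRenewalSet (s l : ℕ) : MeasurableSet (nextRenewalSet Γ s l) :=
  (hc.measurableSet_noRegen s l).inter (hc.measurableSet_renewalSet _)

variable [IsProbabilityMeasure μ]

lemma measure_renewalSet_inter_noRegen (hJ : MeasurableSet J) (k l : ℕ) :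
    μ (renewalSet Γ k ∩ noRegen Γ k l) = μ (renewalSet Γ k) * μ (noRegen Γ 0 l) := by
  have h := hc.measure_inter_renewal hJ (i := k) (A := univ) MeasurableSet.univ
    (measurableSet_path_noRegen 𝒳 l)
  simpa only [preimage_pathFrom_noRegen, univ_inter] using h

/-- The renewal equation, from the decomposition at the last renewal up to time `n`. -/
lemma seqConv_renewal (hJ : MeasurableSet J) (n : ℕ) :
    seqConv (fun k => μ.real (renewalSet Γ k)) (fun k => μ.real (noRegen Γ 0 k)) n = 1 := by
  have h := measureReal_biUnion_finset (μ := μ) (pairwiseDisjoint_renewalSet_inter_noRegen Γ n)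
    (fun k _ => (hc.measurableSet_renewalSet k).inter (hc.measurableSet_noRegen k (n - k)))
  rw [iUnion_renewalSet_inter_noRegen, probReal_univ] at h
  rw [h, seqConv]
  refine Finset.sum_congr rfl fun k _ => ?_
  simp only [measureReal_def, hc.measure_renewalSet_inter_noRegen hJ, ENNReal.toReal_mul]

/-- Decompose at the first renewal after `s` and restart the chain there. -/
lemma real_renewalSet_le_sum (hJ : MeasurableSet J) (s k : ℕ) :
    μ.real (renewalSet Γ (s + 1 + k)) ≤ ∑ l ∈ Finset.range (k + 1),
      μ.real (nextRenewalSet Γ s l) * μ.real (renewalSet Γ (k - l)) := by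
  refine (measureReal_mono (renewalSet_subset_iUnion_nextRenewalSet Γ s k) (measure_ne_top _ _)).trans
    ((measureReal_biUnion_finset_le _ _).trans (Finset.sum_le_sum fun l hl => le_of_eq ?_))
  have hl' : l ≤ k := by simpa [Nat.lt_succ_iff] using hl
  have h := hc.measure_inter_renewal hJ (i := s + 1 + l) (A := noRegen Γ s l)
    (measurableSet_noRegen_strictHistory X (by omega)) (measurableSet_path_renewalSet 𝒳 (k - l))
  have h0 : pathFrom X Γ 0 ⁻¹' renewalSet (fun n (z : ℕ → 𝒳 × Bool) => (z n).2) (k - l) =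
      renewalSet Γ (k - l) := by
    simpa [renewalSet] using renewalSet_inter_preimage_pathFrom X Γ 0 (k - l)
  rw [inter_assoc, renewalSet_inter_preimage_pathFrom, h0, ← inter_assoc,
    show s + 1 + l + (k - l) = s + 1 + k by omega] at h
  simp only [measureReal_def, nextRenewalSet, h, ENNReal.toReal_mul]

/-- The expected number of renewals in `(s, s + r]` is at most that in `[0, r)`. -/
lemma sum_real_renewalSet_le (hJ : MeasurableSet J) (s r : ℕ) :
    ∑ k ∈ Finset.range r, μ.real (renewalSet Γ (s + 1 + k)) ≤
      ∑ k ∈ Finset.range r, μ.real (renewalSet Γ k) := by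
  set U := ∑ k ∈ Finset.range r, μ.real (renewalSet Γ k) with hU
  have hU0 : 0 ≤ U := Finset.sum_nonneg fun _ _ => measureReal_nonneg
  have h1 : ∑ l ∈ Finset.range r, μ.real (nextRenewalSet Γ s l) ≤ 1 := by
    rw [← measureReal_biUnion_finset ((pairwise_disjoint_nextRenewalSet Γ s).set_pairwise _)
      (fun l _ => hc.measurableSet_nextRenewalSet s l)]
    exact measureReal_le_one
  calc ∑ k ∈ Finset.range r, μ.real (renewalSet Γ (s + 1 + k))
      ≤ ∑ k ∈ Finset.range r, ∑ l ∈ Finset.range (k + 1),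
          μ.real (nextRenewalSet Γ s l) * μ.real (renewalSet Γ (k - l)) :=
        Finset.sum_le_sum fun k _ => hc.real_renewalSet_le_sum hJ s k
    _ = ∑ l ∈ Finset.range r, ∑ k ∈ Finset.Ico l r,
          μ.real (nextRenewalSet Γ s l) * μ.real (renewalSet Γ (k - l)) :=
        -- Fix the first renewal after `s`, at `s + 1 + l`: the remaining window has length `r - l ≤
        -- r`, and the weights sum to at most 1 by disjointness.
        Finset.sum_comm' fun k l => by simp; omega
    _ ≤ ∑ l ∈ Finset.range r, μ.real (nextRenewalSet Γ s l) * U := by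
        refine Finset.sum_le_sum fun l _ => ?_
        rw [← Finset.mul_sum, Finset.sum_Ico_eq_sum_range]
        refine mul_le_mul_of_nonneg_left ?_ measureReal_nonneg
        simp only [Nat.add_sub_cancel_left]
        exact Finset.sum_le_sum_of_subset_of_nonneg
          (Finset.range_subset_range.2 (Nat.sub_le r l)) fun _ _ _ => measureReal_nonneg
    _ ≤ 1 * U := by
        rw [← Finset.sum_mul]
        exact mul_le_mul_of_nonneg_right h1 hU0
    _ = U := one_mul U

end IsSplitChain
end RenewalSequence

/-! ### The stationary measure as a potential of the residual kernel -/

section Stationary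

variable {𝒳 : Type*} [MeasurableSpace 𝒳] {P : Kernel 𝒳 𝒳} {π ν : Measure 𝒳} {J : Set 𝒳} {β : ℝ}

/-- The unnormalized residual `P - β 𝟙_J ν` avoids dividing by `1 - β`, which may vanish. -/
lemma SmallSetCondition.exists_residual [IsMarkovKernel P] [IsProbabilityMeasure ν]
    (h : SmallSetCondition P π ν J β) :
    ∃ K : Kernel 𝒳 𝒳, ∀ x, P x = K x + J.indicator (fun _ => ENNReal.ofReal β) x • ν := by
  have hle : ∀ x, J.indicator (fun _ => ENNReal.ofReal β) x • ν ≤ P x := fun x => by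
    by_cases hx : x ∈ J
    · simpa [hx] using h.minorization x hx
    · simp [hx, Measure.zero_le]
  have hfin : ∀ x, IsFiniteMeasure (J.indicator (fun _ => ENNReal.ofReal β) x • ν) := fun x =>
    isFiniteMeasure_of_le (P x) (hle x)
  refine ⟨⟨fun x => P x - J.indicator (fun _ => ENNReal.ofReal β) x • ν, ?_⟩, fun x => ?_⟩
  · refine Measure.measurable_of_measurable_coe _ fun A hA => ?_
    have : (fun x => (P x - J.indicator (fun _ => ENNReal.ofReal β) x • ν) A) =
        fun x => P x A - J.indicator (fun _ => ENNReal.ofReal β) x * ν A := funext fun x => by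
      have := hfin x
      rw [Measure.sub_apply hA (hle x), Measure.smul_apply, smul_eq_mul]
    rw [this]
    exact (Kernel.measurable_coe P hA).sub
      ((measurable_const.indicator h.measurableSet).mul_const _)
  · have := hfin x
    exact (Measure.sub_add_cancel_of_le (hle x)).symm

lemma SmallSetCondition.le_one [IsMarkovKernel P] [IsProbabilityMeasure ν]
    (h : SmallSetCondition P π ν J β) : β ≤ 1 := by
  obtain ⟨x, hx⟩ : J.Nonempty := nonempty_of_measure_ne_zero h.pos_measure.ne'
  have := h.minorization x hx univ
  simpa using this

variable {K : Kernel 𝒳 𝒳}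

lemma lintegral_kernel_eq_add (hJ : MeasurableSet J)
    (hK : ∀ x, P x = K x + J.indicator (fun _ => ENNReal.ofReal β) x • ν) (ρ : Measure 𝒳)
    {A : Set 𝒳} (hA : MeasurableSet A) :
    ∫⁻ x, P x A ∂ρ = ∫⁻ x, K x A ∂ρ + ENNReal.ofReal β * ρ J * ν A := by
  have : ∀ x, P x A = K x A + J.indicator (fun _ => ENNReal.ofReal β) x * ν A := fun x => by
    rw [hK x, Measure.add_apply, Measure.smul_apply, smul_eq_mul]
  simp_rw [this]
  rw [lintegral_add_left (Kernel.measurable_coe K hA),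
    lintegral_mul_const _ (measurable_const.indicator hJ), lintegral_indicator_const hJ]

/-- A finite measure that is invariant for the residual kernel vanishes, if the chain reaches `J`
from everywhere. -/
lemma eq_zero_of_residual_invariant [IsMarkovKernel P] [IsProbabilityMeasure ν]
    [hirr : Kernel.IsIrreducible π P] (h : SmallSetCondition P π ν J β)
    (hK : ∀ x, P x = K x + J.indicator (fun _ => ENNReal.ofReal β) x • ν) {r : Measure 𝒳}
    [IsFiniteMeasure r] (hr : ∀ A, MeasurableSet A → ∫⁻ x, K x A ∂r = r A) : r = 0 := by
  have hβ : ENNReal.ofReal β ≠ 0 := by simpa using h.beta_pos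
  -- `P` preserves the mass of `r`, while `K` loses exactly `β r(J)`; invariance under `K` forces
  -- the loss to be zero.
  have hrJ : r J = 0 := by
    have h1 := lintegral_kernel_eq_add h.measurableSet hK r MeasurableSet.univ
    rw [hr _ MeasurableSet.univ] at h1
    simp only [measure_univ, lintegral_one, mul_one] at h1
    have h2 : r univ + 0 = r univ + ENNReal.ofReal β * r J := by rwa [add_zero]
    have h3 := (ENNReal.add_right_inj (measure_ne_top r univ)).1 h2
    simpa [hβ] using h3.symm
  have hinv : Kernel.Invariant P r := by
    refine Measure.ext fun A hA => ?_
    rw [Measure.bind_apply hA (Kernel.aemeasurable P),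
      lintegral_kernel_eq_add h.measurableSet hK r hA, hr A hA, hrJ]
    simp
  have hpow : ∀ n : ℕ, Kernel.Invariant (P ^ n) r := fun n => by
    induction n with
    | zero =>
      rw [pow_zero]
      exact Measure.bind_dirac
    | succ n ih =>
      rw [pow_succ]
      exact ih.comp hinv
  -- Now `r` is invariant under every `P ^ n` and gives `J` no mass, so from almost every point `J`
  -- is never reached, against irreducibility.
  have hae : ∀ᵐ x ∂r, ∀ n : ℕ, (P ^ n) x J = 0 := by
    refine ae_all_iff.2 fun n => ?_
    have h1 := congrArg (fun ρ => ρ J) (hpow n)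
    rw [hrJ, Measure.bind_apply h.measurableSet (Kernel.aemeasurable _),
      lintegral_eq_zero_iff (Kernel.measurable_coe _ h.measurableSet)] at h1
    exact h1
  rw [← ae_eq_bot, ← Filter.eventually_false_iff_eq_bot]
  filter_upwards [hae] with x hx
  obtain ⟨n, hn⟩ := hirr.irreducible h.measurableSet h.pos_measure x
  exact hn.ne' (hx n)

/-- The stationary distribution is proportional to the potential `∑ ν K ^ l` of the regeneration
measure under the residual kernel. -/
theorem eq_smul_sum_residual [IsProbabilityMeasure π] [IsMarkovKernel P] [IsProbabilityMeasure ν]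
    (hstat : Kernel.Invariant P π) (hirr : Kernel.IsIrreducible π P)
    (h : SmallSetCondition P π ν J β)
    (hK : ∀ x, P x = K x + J.indicator (fun _ => ENNReal.ofReal β) x • ν)
    {κ : ℕ → Measure 𝒳} (h0 : κ 0 = ν)
    (hs : ∀ l A, MeasurableSet A → κ (l + 1) A = ∫⁻ x, K x A ∂κ l) :
    π = (ENNReal.ofReal β * π J) • Measure.sum κ := by
  set c := ENNReal.ofReal β * π J with hc
  have hπ : ∀ A, MeasurableSet A → π A = ∫⁻ x, K x A ∂π + c * ν A := fun A hA => by
    have h1 := congrArg (fun ρ => ρ A) hstat.def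
    rw [Measure.bind_apply hA (Kernel.aemeasurable P),
      lintegral_kernel_eq_add h.measurableSet hK π hA] at h1
    exact h1.symm
  -- Iterating `π = π K + c ν`, with the nonnegative remainder dropped.
  have hpart : ∀ n, c • ∑ l ∈ Finset.range n, κ l ≤ π := fun n => by
    induction n with
    | zero => simp [Measure.zero_le]
    | succ n ih =>
      refine Measure.le_iff.2 fun A hA => ?_
      rw [hπ A hA, Measure.smul_apply, Measure.finsetSum_apply, Finset.sum_range_succ', h0,
        smul_eq_mul, mul_add]
      gcongr
      simp only [hs _ A hA]
      rw [← lintegral_finsetSum_measure, ← smul_eq_mul, ← lintegral_smul_measure]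
      exact lintegral_mono' ih le_rfl
  have hle : c • Measure.sum κ ≤ π := Measure.le_iff.2 fun A hA => by
    rw [Measure.smul_apply, Measure.sum_apply _ hA, smul_eq_mul, ← ENNReal.tsum_mul_left]
    refine ENNReal.tsum_le_of_sum_range_le fun n => ?_
    rw [← Finset.mul_sum, ← Measure.finsetSum_apply]
    exact hpart n A
  have hfin : IsFiniteMeasure (c • Measure.sum κ) := isFiniteMeasure_of_le π hle
  have hm : ∀ A, MeasurableSet A →
      (c • Measure.sum κ) A = ∫⁻ x, K x A ∂(c • Measure.sum κ) + c * ν A := fun A hA => by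
    rw [lintegral_smul_measure, lintegral_sum_measure, Measure.smul_apply,
      Measure.sum_apply _ hA, tsum_eq_zero_add' ENNReal.summable, h0, smul_eq_mul, smul_eq_mul,
      mul_add, add_comm]
    simp only [hs _ A hA]
  have hadd : π - c • Measure.sum κ + c • Measure.sum κ = π := Measure.sub_add_cancel_of_le hle
  -- Both `π` and the potential solve `ρ = ρ K + c ν`, so their difference is invariant for `K`.
  have hr0 : π - c • Measure.sum κ = 0 := by
    refine eq_zero_of_residual_invariant h hK (π := π) fun A hA => ?_
    have h1 := hπ A hA
    rw [← hadd, Measure.add_apply, lintegral_add_measure, add_assoc, ← hm A hA] at h1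
    exact ((ENNReal.add_left_inj (measure_ne_top _ A)).1 h1).symm
  rw [hr0, zero_add] at hadd
  exact hadd.symm

end Stationary

/-! ### Kac's formula for the first block -/

section Occupation

variable {Ω 𝒳 : Type*} [MeasurableSpace Ω] [MeasurableSpace 𝒳]

/-- The law of `X l` on the event that there is no regeneration before time `l`. -/
noncomputable def occupation (μ : Measure Ω) (X : ℕ → Ω → 𝒳) (Γ : ℕ → Ω → Bool) (l : ℕ) :
    Measure 𝒳 :=
  (μ.restrict (noRegen Γ 0 l)).map (X l)

variable {P K : Kernel 𝒳 𝒳} {π ν : Measure 𝒳} {J : Set 𝒳} {β : ℝ} {μ : Measure Ω}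
  {X : ℕ → Ω → 𝒳} {Γ : ℕ → Ω → Bool}

instance isFiniteMeasure_occupation [IsFiniteMeasure μ] (l : ℕ) :
    IsFiniteMeasure (occupation μ X Γ l) := by
  unfold occupation
  infer_instance

/-- If `β = 1` and `x ∈ J`, the denominator vanishes, but then `K x` has total mass zero and both
sides are zero. -/
lemma residualProb_mul [IsMarkovKernel P] [IsProbabilityMeasure ν] (hβ0 : 0 ≤ β)
    (hK : ∀ x, P x = K x + J.indicator (fun _ => ENNReal.ofReal β) x • ν) (x : 𝒳) (A : Set 𝒳) :
    (1 - J.indicator (fun _ => β) x) * residualProb P ν J β x A = (K x).real A := by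
  have hKle : K x ≤ P x := by
    rw [hK x]
    exact Measure.le_add_right le_rfl
  have : IsFiniteMeasure (K x) := isFiniteMeasure_of_le _ hKle
  have hind : (J.indicator (fun _ => ENNReal.ofReal β) x) =
      ENNReal.ofReal (J.indicator (fun _ => β) x) := by
    by_cases hx : x ∈ J <;> simp [hx]
  have hind0 : 0 ≤ J.indicator (fun _ => β) x := indicator_nonneg (fun _ _ => hβ0) x
  have hreal : ∀ B, (P x).real B = (K x).real B + J.indicator (fun _ => β) x * ν.real B := by
    intro B
    rw [measureReal_def, hK x, hind, Measure.add_apply, Measure.smul_apply, smul_eq_mul,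
      ENNReal.toReal_add (measure_ne_top _ _)
        (ENNReal.mul_ne_top ENNReal.ofReal_ne_top (measure_ne_top _ _)), ENNReal.toReal_mul,
      ENNReal.toReal_ofReal hind0]
    rfl
  unfold residualProb
  by_cases h1 : 1 - J.indicator (fun _ => β) x = 0
  · have h2 := hreal univ
    rw [probReal_univ (μ := P x), probReal_univ (μ := ν), show J.indicator (fun _ => β) x = 1 by linarith] at h2
    have h3 : (K x).real A ≤ (K x).real univ := measureReal_mono (subset_univ A)
    have h4 : 0 ≤ (K x).real A := measureReal_nonneg
    rw [h1, zero_mul]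
    linarith
  · rw [mul_div_cancel₀ _ h1, hreal A]
    ring

namespace IsSplitChain

variable (hc : IsSplitChain P ν J β μ X Γ)
include hc

lemma occupation_zero : occupation μ X Γ 0 = ν := by
  have : noRegen Γ 0 0 = univ := eq_univ_of_forall fun ω j hj => by omega
  rw [occupation, this, Measure.restrict_univ, hc.init]

lemma occupation_univ (l : ℕ) : occupation μ X Γ l univ = μ (noRegen Γ 0 l) := by
  rw [occupation, Measure.map_apply (hc.measurable_X l) MeasurableSet.univ]
  simp

variable [IsProbabilityMeasure μ]

lemma map_restrict_noRegen_succ (hJ : MeasurableSet J) (hβ1 : β ≤ 1) (l : ℕ) :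
    (μ.restrict (noRegen Γ 0 (l + 1))).map (X l) =
      (occupation μ X Γ l).withDensity
        fun x => ENNReal.ofReal (1 - J.indicator (fun _ => β) x) := by
  have hlam : ∀ A, MeasurableSet A →
      (occupation μ X Γ l).real A = μ.real (noRegen Γ 0 l ∩ X l ⁻¹' A) := fun A hA => by
    rw [occupation, measureReal_def, Measure.map_apply (hc.measurable_X l) hA,
      Measure.restrict_apply (hc.measurable_X l hA), inter_comm, measureReal_def]
  have hint : Integrable (fun x => J.indicator (fun _ => β) x) (occupation μ X Γ l) :=
    (integrable_const β).indicator hJ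
  ext A hA
  have hreg := hc.real_inter_regeneration hJ (n := l) (G := noRegen Γ 0 l ∩ X l ⁻¹' A)
    ((measurableSet_noRegen_historyX X (by omega)).inter (measurable_X_historyX X Γ le_rfl hA))
  have hdiff : X l ⁻¹' A ∩ noRegen Γ 0 (l + 1) =
      (noRegen Γ 0 l ∩ X l ⁻¹' A) \ (noRegen Γ 0 l ∩ X l ⁻¹' A ∩ Γ l ⁻¹' {true}) := by
    rw [noRegen_succ]
    ext ω
    simp
    tauto
  have hms : MeasurableSet (noRegen Γ 0 l ∩ X l ⁻¹' A) :=
    (hc.measurableSet_noRegen 0 l).inter (hc.measurable_X l hA)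
  have hI : ∫ x in A, (1 - J.indicator (fun _ => β) x) ∂(occupation μ X Γ l) =
      μ.real (X l ⁻¹' A ∩ noRegen Γ 0 (l + 1)) := by
    rw [integral_sub (integrable_const _).integrableOn hint.integrableOn,
      setIntegral_indicator hJ, setIntegral_const, setIntegral_const, hlam A hA,
      hlam _ (hA.inter hJ), hdiff, measureReal_sdiff inter_subset_left
        (hms.inter (hc.measurable_Γ l (measurableSet_singleton _))), hreg, inter_assoc]
    simp [mul_comm]
  rw [Measure.map_apply (hc.measurable_X l) hA, Measure.restrict_apply (hc.measurable_X l hA),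
    withDensity_apply _ hA, ← ofReal_integral_eq_lintegral_ofReal
      (f := fun x => 1 - J.indicator (fun _ => β) x)
      ((integrable_const _).sub hint).integrableOn (Filter.Eventually.of_forall fun x => ?_), hI,
    ofReal_measureReal]
  by_cases hx : x ∈ J <;> simp [hx, hβ1]

/-- Surviving time `l` thins the law by `1 - β 𝟙_J`, exactly the normalizing factor of the residual
transition that follows; the two cancel and leave `K`. -/
lemma occupation_succ [IsMarkovKernel P] [IsProbabilityMeasure ν] (hJ : MeasurableSet J)
    (hβ0 : 0 ≤ β) (hβ1 : β ≤ 1)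
    (hK : ∀ x, P x = K x + J.indicator (fun _ => ENNReal.ofReal β) x • ν) (l : ℕ) {A : Set 𝒳}
    (hA : MeasurableSet A) :
    occupation μ X Γ (l + 1) A = ∫⁻ x, K x A ∂occupation μ X Γ l := by
  have hG : MeasurableSet[historyXΓ X Γ l] (noRegen Γ 0 (l + 1)) :=
    measurableSet_noRegen_strictHistory X (n := l + 1) (by omega)
  have hR : Measurable fun x => residualProb P ν J β x A := measurable_residualProb hJ hA
  have hI : Measurable (J.indicator fun _ : 𝒳 => β) := measurable_const.indicator hJ
  have hKle : ∀ x, K x A ≤ 1 := fun x => by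
    have : K x ≤ P x := by
      rw [hK x]
      exact Measure.le_add_right le_rfl
    exact (this A).trans prob_le_one
  have h1 : (occupation μ X Γ (l + 1)).real A =
      ∫ x, (K x).real A ∂occupation μ X Γ l := by
    calc (occupation μ X Γ (l + 1)).real A
        = μ.real (noRegen Γ 0 (l + 1) ∩ X (l + 1) ⁻¹' A) := by
          rw [occupation, measureReal_def, Measure.map_apply (hc.measurable_X _) hA,
            Measure.restrict_apply (hc.measurable_X _ hA), inter_comm, measureReal_def]
      _ = ∫ ω in noRegen Γ 0 (l + 1), residualProb P ν J β (X l ω) A ∂μ := by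
          rw [hc.real_inter_transition hG hA]
          refine setIntegral_congr_fun (hc.measurableSet_noRegen 0 (l + 1)) fun ω hω => ?_
          have : Γ l ω = false := by simpa using hω l (by omega)
          simp [stepProb, this]
      _ = ∫ x, residualProb P ν J β x A ∂(μ.restrict (noRegen Γ 0 (l + 1))).map (X l) := by
          rw [integral_map (hc.measurable_X l).aemeasurable hR.aestronglyMeasurable]
      _ = ∫ x, (K x).real A ∂occupation μ X Γ l := by
          rw [hc.map_restrict_noRegen_succ hJ hβ1 l, integral_withDensity_eq_integral_toReal_smul
            (f := fun x => ENNReal.ofReal (1 - J.indicator (fun _ => β) x))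
            (measurable_const.sub hI).ennreal_ofReal (by simp)]
          refine integral_congr_ae (Filter.Eventually.of_forall fun x => ?_)
          have : 0 ≤ 1 - J.indicator (fun _ => β) x := by
            by_cases hx : x ∈ J <;> simp [hx, hβ1]
          simp only [ENNReal.toReal_ofReal this, smul_eq_mul]
          exact residualProb_mul hβ0 hK x A
  simp only [measureReal_def] at h1
  rw [integral_toReal (Kernel.measurable_coe K hA).aemeasurable
    (Filter.Eventually.of_forall fun x => (hKle x).trans_lt ENNReal.one_lt_top)] at h1
  refine (ENNReal.toReal_eq_toReal_iff' (measure_ne_top _ _) (ne_of_lt ?_)).1 h1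
  calc ∫⁻ x, K x A ∂occupation μ X Γ l ≤ ∫⁻ _, 1 ∂occupation μ X Γ l :=
        lintegral_mono fun x => hKle x
    _ < ∞ := by simp

/-- Kac's formula: the stationary distribution is proportional to the expected occupation measure
of the first block. -/
theorem stationary_eq_smul_occupation [IsProbabilityMeasure π] [IsMarkovKernel P]
    [IsProbabilityMeasure ν] (hstat : Kernel.Invariant P π) (hirr : Kernel.IsIrreducible π P)
    (h : SmallSetCondition P π ν J β) :
    π = (ENNReal.ofReal β * π J) • Measure.sum (occupation μ X Γ) := by
  obtain ⟨K, hK⟩ := h.exists_residual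
  exact eq_smul_sum_residual hstat hirr h hK hc.occupation_zero fun l A hA =>
    hc.occupation_succ h.measurableSet h.beta_pos.le h.le_one hK l hA

end IsSplitChain
end Occupation

/-! ### Blocks as functionals of the path -/

section PathBlock

variable {Ω 𝒳 : Type*}

/-- The time of the first regeneration of a path, with value `0` if there is none. -/
noncomputable def firstRegen (z : ℕ → 𝒳 × Bool) : ℕ :=
  sInf {m : ℕ | 0 < m ∧ (z (m - 1)).2 = true}

/-- The sum of `g` along a path up to its first regeneration. -/
noncomputable def pathBlock (g : 𝒳 → ℝ) (z : ℕ → 𝒳 × Bool) : ℝ :=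
  ∑ l ∈ Finset.range (firstRegen z), g (z l).1

lemma firstRegen_mem {z : ℕ → 𝒳 × Bool} (h : ∃ k, (z k).2 = true) :
    0 < firstRegen z ∧ (z (firstRegen z - 1)).2 = true := by
  obtain ⟨k, hk⟩ := h
  exact Nat.sInf_mem (s := {m : ℕ | 0 < m ∧ (z (m - 1)).2 = true}) ⟨k + 1, by simp, hk⟩

lemma lt_firstRegen_iff {z : ℕ → 𝒳 × Bool} (h : ∃ k, (z k).2 = true) {l : ℕ} :
    l < firstRegen z ↔ ∀ j < l, (z j).2 = false := by
  obtain ⟨h0, h1⟩ := firstRegen_mem h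
  constructor
  · intro hl j hj
    by_contra hz
    have : firstRegen z ≤ j + 1 := Nat.sInf_le ⟨by omega, by simpa using hz⟩
    omega
  · intro hl
    by_contra hlt
    have := hl (firstRegen z - 1) (by omega)
    simp [h1] at this

lemma firstRegen_eq_iff (z : ℕ → 𝒳 × Bool) (m : ℕ) :
    firstRegen z = m + 1 ↔ (z m).2 = true ∧ ∀ j < m, (z j).2 = false := by
  constructor
  · intro h
    have hex : ∃ k, (z k).2 = true := by
      have : firstRegen z ∈ {m : ℕ | 0 < m ∧ (z (m - 1)).2 = true} :=
        Nat.sInf_mem (Nat.nonempty_of_pos_sInf (by unfold firstRegen at h; omega))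
      exact ⟨_, this.2⟩
    have h1 := (firstRegen_mem hex).2
    rw [h, Nat.add_sub_cancel] at h1
    exact ⟨h1, (lt_firstRegen_iff hex).1 (by omega)⟩
  · rintro ⟨h1, h2⟩
    have h3 := (lt_firstRegen_iff ⟨m, h1⟩).2 h2
    have : firstRegen z ≤ m + 1 := Nat.sInf_le ⟨by omega, by simpa using h1⟩
    omega

/-- Writing a block as a series over deterministic times, with survival indicators, makes it
accessible to Fubini and to the filtration. -/
lemma hasSum_pathBlock (X : ℕ → Ω → 𝒳) (Γ : ℕ → Ω → Bool) (g : 𝒳 → ℝ) {i : ℕ} {ω : Ω}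
    (h : ∃ k, Γ (i + k) ω = true) :
    HasSum (fun l => (noRegen Γ i l).indicator (fun ω => g (X (i + l) ω)) ω)
      (pathBlock g (pathFrom X Γ i ω)) := by
  have hlt : ∀ l, l < firstRegen (pathFrom X Γ i ω) ↔ ω ∈ noRegen Γ i l := fun l =>
    lt_firstRegen_iff (z := pathFrom X Γ i ω) h
  have hs : pathBlock g (pathFrom X Γ i ω) = ∑ l ∈ Finset.range (firstRegen (pathFrom X Γ i ω)),
      (noRegen Γ i l).indicator (fun ω => g (X (i + l) ω)) ω := by
    refine Finset.sum_congr rfl fun l hl => ?_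
    rw [indicator_of_mem ((hlt l).1 (Finset.mem_range.1 hl))]
    rfl
  rw [hs]
  refine hasSum_sum_of_ne_finset_zero fun l hl => indicator_of_notMem (fun hmem => hl ?_) _
  exact Finset.mem_range.2 ((hlt l).2 hmem)

/-- At a later renewal time `j`, the block that started at `i` is a function of the history. -/
lemma pathBlock_eq_sum_of_mem_renewalSet (X : ℕ → Ω → 𝒳) (Γ : ℕ → Ω → Bool) (g : 𝒳 → ℝ)
    {i j : ℕ} (hij : i < j) {ω : Ω} (h : ω ∈ renewalSet Γ j) :
    pathBlock g (pathFrom X Γ i ω) = ∑ l ∈ Finset.range (j - i),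
      (noRegen Γ i l).indicator (fun ω => g (X (i + l) ω)) ω := by
  have hex : ∃ k, Γ (i + k) ω = true := by
    refine ⟨j - 1 - i, ?_⟩
    obtain ⟨j, rfl⟩ : ∃ j', j = j' + 1 := ⟨j - 1, by omega⟩
    rw [show i + (j + 1 - 1 - i) = j by omega]
    exact h
  refine (hasSum_pathBlock X Γ g hex).unique
    (hasSum_sum_of_ne_finset_zero fun l hl => indicator_of_notMem ?_ _)
  refine notMem_noRegen_of_mem_renewalSet h hij ?_
  simp at hl
  omega

/-- The block sum of `g` over the block that starts at time `i`, and `0` if there is none. -/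
noncomputable def renewalBlock (X : ℕ → Ω → 𝒳) (Γ : ℕ → Ω → Bool) (g : 𝒳 → ℝ) (i : ℕ) (ω : Ω) :
    ℝ :=
  (renewalSet Γ i).indicator (fun ω => pathBlock g (pathFrom X Γ i ω)) ω

lemma renewalBlock_sq (X : ℕ → Ω → 𝒳) (Γ : ℕ → Ω → Bool) (g : 𝒳 → ℝ) (i : ℕ) : (fun ω => renewalBlock X Γ g i ω ^ 2) =
    (renewalSet Γ i).indicator fun ω => pathBlock g (pathFrom X Γ i ω) ^ 2 := by
  funext ω
  by_cases h : ω ∈ renewalSet Γ i <;> simp [renewalBlock, h]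

variable [MeasurableSpace 𝒳]

lemma measurable_firstRegen : Measurable (firstRegen (𝒳 := 𝒳)) := by
  have hs : ∀ m, MeasurableSet {z : ℕ → 𝒳 × Bool | firstRegen z = m + 1} := fun m => by
    have : {z : ℕ → 𝒳 × Bool | firstRegen z = m + 1} =
        (fun z : ℕ → 𝒳 × Bool => (z m).2) ⁻¹' {true} ∩
          noRegen (fun n (z : ℕ → 𝒳 × Bool) => (z n).2) 0 m := by
      ext z
      simp [firstRegen_eq_iff, noRegen]
    rw [this]
    exact ((measurable_snd.comp (measurable_pi_apply m)) (measurableSet_singleton _)).inter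
      (measurableSet_path_noRegen 𝒳 m)
  refine measurable_to_countable' fun m => ?_
  cases m with
  | zero =>
    have : firstRegen (𝒳 := 𝒳) ⁻¹' {0} = (⋃ m, {z | firstRegen z = m + 1})ᶜ := by
      ext z
      simp only [mem_preimage, mem_singleton_iff, mem_compl_iff, mem_iUnion, mem_ofPred_eq]
      constructor
      · rintro h ⟨m, hm⟩
        omega
      · intro h
        by_contra h0
        exact h ⟨firstRegen z - 1, by omega⟩
    rw [this]
    exact (MeasurableSet.iUnion hs).compl
  | succ m => exact hs m

lemma measurable_pathBlock {g : 𝒳 → ℝ} (hg : Measurable g) : Measurable (pathBlock g) := by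
  -- The random length is handled by joint measurability in the path and a countable length
  -- variable.
  have : Measurable fun p : (ℕ → 𝒳 × Bool) × ℕ => ∑ l ∈ Finset.range p.2, g (p.1 l).1 :=
    measurable_from_prod_countable_left fun m => Finset.measurable_sum (Finset.range m)
      fun l _ => hg.comp (measurable_fst.comp (measurable_pi_apply l))
  exact this.comp (measurable_id.prodMk measurable_firstRegen)

end PathBlock

/-! ### Moments and orthogonality of the blocks -/

section BlockMoments

variable {Ω 𝒳 : Type*} [MeasurableSpace Ω] [MeasurableSpace 𝒳] {P : Kernel 𝒳 𝒳}
  {π ν : Measure 𝒳} {J : Set 𝒳} {β : ℝ} {μ : Measure Ω} {X : ℕ → Ω → 𝒳} {Γ : ℕ → Ω → Bool}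

namespace IsSplitChain

variable (hc : IsSplitChain P ν J β μ X Γ)
include hc

lemma measurable_renewalBlock {g : 𝒳 → ℝ} (hg : Measurable g) (i : ℕ) :
    Measurable (renewalBlock X Γ g i) :=
  ((measurable_pathBlock hg).comp (hc.measurable_pathFrom i)).indicator
    (hc.measurableSet_renewalSet i)

variable [IsProbabilityMeasure μ]

/-- Kac's formula evaluated on the whole space: the total occupation mass times a positive constant
is 1. -/
lemma tsum_noRegen_ne_top [IsProbabilityMeasure π] [IsMarkovKernel P]
    [IsProbabilityMeasure ν] (hstat : Kernel.Invariant P π) (hirr : Kernel.IsIrreducible π P)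
    (h : SmallSetCondition P π ν J β) : ∑' k, μ (noRegen Γ 0 k) ≠ ∞ := by
  have h1 := congrArg (fun ρ => ρ univ) (hc.stationary_eq_smul_occupation hstat hirr h)
  simp only [measure_univ, Measure.smul_apply, Measure.sum_apply _ MeasurableSet.univ,
    hc.occupation_univ, smul_eq_mul] at h1
  intro htop
  have hβ : ENNReal.ofReal β ≠ 0 := by simpa using h.beta_pos
  rw [htop, ENNReal.mul_top (mul_ne_zero hβ h.pos_measure.ne')] at h1
  exact ENNReal.one_ne_top h1

/-- After a renewal, the chance of surviving `k` steps is a term of a convergent series and tends to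
0, so almost surely each renewal is followed by a regeneration; induct along time. -/
lemma ae_infinitely_many_regen (hJ : MeasurableSet J) (hq : ∑' k, μ (noRegen Γ 0 k) ≠ ∞) :
    ∀ᵐ ω ∂μ, ∀ i, ∃ k, Γ (i + k) ω = true := by
  have h0 : ∀ i, ∀ᵐ ω ∂μ, ω ∈ renewalSet Γ i → ∃ k, Γ (i + k) ω = true := fun i => by
    rw [ae_iff]
    refine le_antisymm (ge_of_tendsto' (ENNReal.tendsto_atTop_zero_of_tsum_ne_top hq)
      fun k => ?_) zero_le
    calc μ {ω | ¬(ω ∈ renewalSet Γ i → ∃ k, Γ (i + k) ω = true)}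
        ≤ μ (renewalSet Γ i ∩ noRegen Γ i k) := by
          refine measure_mono fun ω hω => ?_
          simp only [mem_ofPred_eq, Classical.not_imp, not_exists, Bool.not_eq_true] at hω
          exact ⟨hω.1, fun j _ => hω.2 j⟩
      _ = μ (renewalSet Γ i) * μ (noRegen Γ 0 k) := hc.measure_renewalSet_inter_noRegen hJ i k
      _ ≤ 1 * μ (noRegen Γ 0 k) := by
          gcongr
          exact prob_le_one
      _ = μ (noRegen Γ 0 k) := one_mul _
  filter_upwards [ae_all_iff.2 h0] with ω hω i
  induction i with
  | zero => exact hω 0 (mem_univ ω)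
  | succ i ih =>
    obtain ⟨k, hk⟩ := ih
    cases k with
    | zero => exact hω (i + 1) hk
    | succ k => exact ⟨k, by rwa [show i + 1 + k = i + (k + 1) by omega]⟩

/-- The expected sum of a centred function over the first block vanishes. -/
lemma integral_pathBlock_eq_zero [IsProbabilityMeasure π] [IsMarkovKernel P]
    [IsProbabilityMeasure ν] (hstat : Kernel.Invariant P π) (hirr : Kernel.IsIrreducible π P)
    (h : SmallSetCondition P π ν J β) {g : 𝒳 → ℝ} (hg : Measurable g) (hgπ : Integrable g π)
    (hg0 : ∫ x, g x ∂π = 0) : ∫ ω, pathBlock g (pathFrom X Γ 0 ω) ∂μ = 0 := by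
  have hπ := hc.stationary_eq_smul_occupation hstat hirr h
  have hβ : ENNReal.ofReal β ≠ 0 := by simpa using h.beta_pos
  have hc0 : ENNReal.ofReal β * π J ≠ 0 := mul_ne_zero hβ h.pos_measure.ne'
  have hctop : ENNReal.ofReal β * π J ≠ ∞ :=
    ENNReal.mul_ne_top ENNReal.ofReal_ne_top (measure_ne_top _ _)
  rw [hπ, integrable_smul_measure hc0 hctop] at hgπ
  rw [hπ, integral_smul_measure, smul_eq_mul, mul_eq_zero, or_iff_right
    (ENNReal.toReal_ne_zero.2 ⟨hc0, hctop⟩), integral_sum_measure hgπ] at hg0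
  have hF : ∀ l, Measurable ((noRegen Γ 0 l).indicator fun ω => g (X (0 + l) ω)) := fun l =>
    (hg.comp (hc.measurable_X _)).indicator (hc.measurableSet_noRegen 0 l)
  -- Integrability under `π` is, by Kac's formula, summability of these `L¹` norms, which justifies
  -- exchanging sum and integral.
  have hsum : ∑' l, ∫⁻ ω, ‖(noRegen Γ 0 l).indicator (fun ω => g (X (0 + l) ω)) ω‖ₑ ∂μ ≠ ∞ := by
    have h1 := hgπ.2
    rw [HasFiniteIntegral, lintegral_sum_measure] at h1
    convert h1.ne using 3 with l
    simp only [zero_add]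
    simp_rw [enorm_indicator_eq_indicator_enorm]
    rw [lintegral_indicator (hc.measurableSet_noRegen 0 l), occupation,
      lintegral_map hg.enorm (hc.measurable_X l)]
  calc ∫ ω, pathBlock g (pathFrom X Γ 0 ω) ∂μ
      = ∫ ω, ∑' l, (noRegen Γ 0 l).indicator (fun ω => g (X (0 + l) ω)) ω ∂μ := by
        refine integral_congr_ae ?_
        filter_upwards [hc.ae_infinitely_many_regen h.measurableSet
          (hc.tsum_noRegen_ne_top hstat hirr h)] with ω hω
        exact (hasSum_pathBlock X Γ g (hω 0)).tsum_eq.symm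
    _ = ∑' l, ∫ ω, (noRegen Γ 0 l).indicator (fun ω => g (X (0 + l) ω)) ω ∂μ :=
        integral_tsum (fun l => (hF l).aestronglyMeasurable) hsum
    _ = ∑' l, ∫ x, g x ∂occupation μ X Γ l := by
        refine tsum_congr fun l => ?_
        rw [integral_indicator (hc.measurableSet_noRegen 0 l), occupation, zero_add,
          integral_map (hc.measurable_X l).aemeasurable hg.aestronglyMeasurable]
    _ = 0 := hg0

lemma map_pathFrom_renewal (hJ : MeasurableSet J) (i : ℕ) :
    (μ.restrict (renewalSet Γ i)).map (pathFrom X Γ i) =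
      μ (renewalSet Γ i) • μ.map (pathFrom X Γ 0) := by
  ext S hS
  have h := hc.measure_inter_renewal hJ (i := i) (A := univ) MeasurableSet.univ hS
  rw [Measure.map_apply (hc.measurable_pathFrom i) hS,
    Measure.restrict_apply (hc.measurable_pathFrom i hS), Measure.smul_apply,
    Measure.map_apply (hc.measurable_pathFrom 0) hS, inter_comm, smul_eq_mul]
  simpa using h

lemma integrableOn_renewal (hJ : MeasurableSet J) {F : (ℕ → 𝒳 × Bool) → ℝ} (hF : Measurable F)
    (hint : Integrable (fun ω => F (pathFrom X Γ 0 ω)) μ) (i : ℕ) :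
    IntegrableOn (fun ω => F (pathFrom X Γ i ω)) (renewalSet Γ i) μ := by
  have h0 : Integrable F (μ.map (pathFrom X Γ 0)) :=
    (integrable_map_measure hF.aestronglyMeasurable (hc.measurable_pathFrom 0).aemeasurable).2 hint
  have h1 := h0.smul_measure (measure_ne_top μ (renewalSet Γ i))
  rw [← hc.map_pathFrom_renewal hJ i] at h1
  exact (integrable_map_measure hF.aestronglyMeasurable
    (hc.measurable_pathFrom i).aemeasurable).1 h1

lemma setIntegral_renewal (hJ : MeasurableSet J) {F : (ℕ → 𝒳 × Bool) → ℝ} (hF : Measurable F)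
    (i : ℕ) : ∫ ω in renewalSet Γ i, F (pathFrom X Γ i ω) ∂μ =
      μ.real (renewalSet Γ i) * ∫ ω, F (pathFrom X Γ 0 ω) ∂μ := by
  rw [← integral_map (hc.measurable_pathFrom i).aemeasurable hF.aestronglyMeasurable,
    hc.map_pathFrom_renewal hJ i, integral_smul_measure,
    integral_map (hc.measurable_pathFrom 0).aemeasurable hF.aestronglyMeasurable]
  rfl

/-- At a renewal, a function of the history and a centred function of the future are orthogonal. -/
lemma setIntegral_mul_eq_zero (hJ : MeasurableSet J) {j : ℕ} {φ : Ω → ℝ}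
    (hφ : Measurable[strictHistory X Γ j] φ) {F : (ℕ → 𝒳 × Bool) → ℝ} (hF : Measurable F)
    (h0 : ∫ ω, F (pathFrom X Γ 0 ω) ∂μ = 0) :
    ∫ ω in renewalSet Γ j, φ ω * F (pathFrom X Γ j ω) ∂μ = 0 := by
  by_cases hj : μ (renewalSet Γ j) = 0
  · exact setIntegral_measure_zero _ hj
  have hR := hc.measurableSet_renewalSet j
  have hFj : Measurable fun ω => F (pathFrom X Γ j ω) := hF.comp (hc.measurable_pathFrom j)
  have hφ' : Measurable φ := hφ.mono (hc.strictHistory_le j) le_rfl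
  -- Given a renewal at `j`, past and future are independent, so the integral of the product factors
  -- and the centred factor kills it.
  have hind : IndepFun φ (fun ω => F (pathFrom X Γ j ω)) (cond μ (renewalSet Γ j)) := by
    rw [indepFun_iff_measure_inter_preimage_eq_mul]
    intro s t hs ht
    have e1 := hc.measure_inter_renewal hJ (hφ hs) (hF ht)
    have e2 := hc.measure_inter_renewal hJ (i := j) (A := univ) MeasurableSet.univ (hF ht)
    rw [univ_inter] at e2
    rw [cond_apply hR, cond_apply hR, cond_apply hR]
    change _ * μ (_ ∩ (_ ∩ pathFrom X Γ j ⁻¹' (F ⁻¹' t))) = _ * (_ * μ (_ ∩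
      pathFrom X Γ j ⁻¹' (F ⁻¹' t)))
    rw [← inter_assoc, inter_comm (renewalSet Γ j) (φ ⁻¹' s), e1, e2]
    have e3 : (μ (renewalSet Γ j))⁻¹ * μ (renewalSet Γ j) = 1 :=
      ENNReal.inv_mul_cancel hj (measure_ne_top _ _)
    rw [← mul_assoc (μ (renewalSet Γ j))⁻¹ (μ (renewalSet Γ j)), e3]
    ring
  have h1 := hind.integral_fun_mul_eq_mul_integral hφ'.aestronglyMeasurable
    hFj.aestronglyMeasurable
  rw [ProbabilityTheory.cond, integral_smul_measure, integral_smul_measure,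
    integral_smul_measure, hc.setIntegral_renewal hJ hF, h0, mul_zero, smul_zero, mul_zero,
    smul_eq_mul, mul_eq_zero] at h1
  refine h1.resolve_left (ENNReal.toReal_ne_zero.2 ⟨?_, ?_⟩)
  · exact ENNReal.inv_ne_zero.2 (measure_ne_top _ _)
  · exact ENNReal.inv_ne_top.2 hj

lemma memLp_renewalBlock (hJ : MeasurableSet J) {g : 𝒳 → ℝ} (hg : Measurable g)
    (h2 : Integrable (fun ω => pathBlock g (pathFrom X Γ 0 ω) ^ 2) μ) (i : ℕ) :
    MemLp (renewalBlock X Γ g i) 2 μ := by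
  rw [memLp_two_iff_integrable_sq (hc.measurable_renewalBlock hg i).aestronglyMeasurable,
    renewalBlock_sq X Γ, integrable_indicator_iff (hc.measurableSet_renewalSet i)]
  exact hc.integrableOn_renewal hJ ((measurable_pathBlock hg).pow_const 2) h2 i

lemma integral_renewalBlock_sq (hJ : MeasurableSet J) {g : 𝒳 → ℝ} (hg : Measurable g) (i : ℕ) :
    ∫ ω, renewalBlock X Γ g i ω ^ 2 ∂μ =
      μ.real (renewalSet Γ i) * ∫ ω, pathBlock g (pathFrom X Γ 0 ω) ^ 2 ∂μ := by
  rw [renewalBlock_sq X Γ, integral_indicator (hc.measurableSet_renewalSet i)]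
  exact hc.setIntegral_renewal hJ ((measurable_pathBlock hg).pow_const 2) i

lemma integral_renewalBlock_mul (hJ : MeasurableSet J) {g : 𝒳 → ℝ} (hg : Measurable g)
    (h0 : ∫ ω, pathBlock g (pathFrom X Γ 0 ω) ∂μ = 0) {i j : ℕ} (hij : i < j) :
    ∫ ω, renewalBlock X Γ g i ω * renewalBlock X Γ g j ω ∂μ = 0 := by
  -- On a renewal at `j` the block from `i` has already ended, so it can be replaced by this
  -- truncated sum, which is measurable with respect to the strict past of `j`.
  set φ : Ω → ℝ := (renewalSet Γ i).indicator fun ω => ∑ l ∈ Finset.range (j - i),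
    (noRegen Γ i l).indicator (fun ω => g (X (i + l) ω)) ω with hφ
  have hφm : Measurable[strictHistory X Γ j] φ := by
    refine Measurable.indicator ?_ (measurableSet_renewalSet_strictHistory X hij.le)
    refine Finset.measurable_sum _ fun l hl => ?_
    have hl' : i + l < j := by
      have := Finset.mem_range.1 hl
      omega
    refine Measurable.indicator (hg.comp ?_) (measurableSet_noRegen_strictHistory X hl'.le)
    obtain ⟨j, rfl⟩ : ∃ j', j = j' + 1 := ⟨j - 1, by omega⟩
    exact measurable_X_historyXΓ X Γ (by omega)
  have heq : (fun ω => renewalBlock X Γ g i ω * renewalBlock X Γ g j ω) =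
      (renewalSet Γ j).indicator fun ω => φ ω * pathBlock g (pathFrom X Γ j ω) := by
    funext ω
    by_cases hω : ω ∈ renewalSet Γ j
    · rw [indicator_of_mem hω]
      by_cases hi : ω ∈ renewalSet Γ i
      · simp only [renewalBlock, hφ, indicator_of_mem hω, indicator_of_mem hi]
        rw [pathBlock_eq_sum_of_mem_renewalSet X Γ g hij hω]
      · simp [renewalBlock, hφ, hi]
    · simp [renewalBlock, hω]
  rw [heq, integral_indicator (hc.measurableSet_renewalSet j)]
  exact hc.setIntegral_mul_eq_zero hJ hφm (measurable_pathBlock hg) h0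

/-- Wald's second identity for the sum of the blocks that start before time `n`. -/
theorem integral_sum_renewalBlock_sq (hJ : MeasurableSet J) {g : 𝒳 → ℝ} (hg : Measurable g)
    (h0 : ∫ ω, pathBlock g (pathFrom X Γ 0 ω) ∂μ = 0)
    (h2 : Integrable (fun ω => pathBlock g (pathFrom X Γ 0 ω) ^ 2) μ) (n : ℕ) :
    ∫ ω, (∑ i ∈ Finset.range n, renewalBlock X Γ g i ω) ^ 2 ∂μ =
      (∑ i ∈ Finset.range n, μ.real (renewalSet Γ i)) *
        ∫ ω, pathBlock g (pathFrom X Γ 0 ω) ^ 2 ∂μ := by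
  have hL := hc.memLp_renewalBlock hJ hg h2
  induction n with
  | zero => simp
  | succ n ih =>
    have hS : MemLp (fun ω => ∑ i ∈ Finset.range n, renewalBlock X Γ g i ω) 2 μ :=
      memLp_finsetSum _ fun i _ => hL i
    have hint : Integrable (fun ω => (∑ i ∈ Finset.range n, renewalBlock X Γ g i ω) *
        renewalBlock X Γ g n ω) μ := hS.integrable_mul (hL n)
    have hcross : ∫ ω, (∑ i ∈ Finset.range n, renewalBlock X Γ g i ω) *
        renewalBlock X Γ g n ω ∂μ = 0 := by
      have hi : ∀ i ∈ Finset.range n,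
          Integrable (fun ω => renewalBlock X Γ g i ω * renewalBlock X Γ g n ω) μ :=
        fun i _ => (hL i).integrable_mul (hL n)
      simp_rw [Finset.sum_mul]
      rw [integral_finsetSum _ hi]
      exact Finset.sum_eq_zero fun i hi =>
        hc.integral_renewalBlock_mul hJ hg h0 (Finset.mem_range.1 hi)
    calc ∫ ω, (∑ i ∈ Finset.range (n + 1), renewalBlock X Γ g i ω) ^ 2 ∂μ
        = ∫ ω, ((∑ i ∈ Finset.range n, renewalBlock X Γ g i ω) ^ 2 +
            renewalBlock X Γ g n ω ^ 2) +
            2 * ((∑ i ∈ Finset.range n, renewalBlock X Γ g i ω) * renewalBlock X Γ g n ω) ∂μ := by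
          congr 1
          funext ω
          rw [Finset.sum_range_succ]
          ring
      _ = _ := by
          rw [integral_add (by exact hS.integrable_sq.add (hL n).integrable_sq)
            (hint.const_mul 2), integral_add hS.integrable_sq (hL n).integrable_sq,
            integral_const_mul, ih, hc.integral_renewalBlock_sq hJ hg, hcross,
            Finset.sum_range_succ]
          ring

end IsSplitChain
end BlockMoments

/-! ### Pathwise identities for the regeneration epochs -/

section Pathwise

variable {Ω 𝒳 : Type*} {Γ : ℕ → Ω → Bool} {ω : Ω}

/-- `t` is the first renewal time that is at least `n`. -/
def IsFirstRenewal (Γ : ℕ → Ω → Bool) (ω : Ω) (n t : ℕ) : Prop :=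
  n ≤ t ∧ ω ∈ renewalSet Γ t ∧ ∀ m, n ≤ m → ω ∈ renewalSet Γ m → t ≤ m

/-- Induct on `n`. If `n` is a renewal, the block starting there runs exactly from `n` to `t`;
otherwise `t` is also the first renewal from `n` on, and the extra term is zero. -/
lemma sum_range_eq_sum_renewalBlock (X : ℕ → Ω → 𝒳) (g : 𝒳 → ℝ) {n t : ℕ}
    (ht : IsFirstRenewal Γ ω n t) :
    ∑ l ∈ Finset.range t, g (X l ω) = ∑ i ∈ Finset.range n, renewalBlock X Γ g i ω := by
  induction n generalizing t with
  | zero =>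
    obtain rfl : t = 0 := Nat.le_zero.1 (ht.2.2 0 le_rfl (mem_univ ω))
    simp
  | succ n ih =>
    obtain ⟨hnt, htR, hmin⟩ := ht
    rw [Finset.sum_range_succ]
    by_cases hn : ω ∈ renewalSet Γ n
    · rw [← ih ⟨le_rfl, hn, fun m hm _ => hm⟩]
      obtain ⟨d, rfl⟩ : ∃ d, t = n + d + 1 := ⟨t - n - 1, by omega⟩
      have hd : firstRegen (pathFrom X Γ n ω) = d + 1 := by
        refine (firstRegen_eq_iff _ d).2 ⟨htR, fun j hj => ?_⟩
        by_contra h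
        have := hmin (n + j + 1) (by omega) (by simpa [pathFrom, renewalSet] using h)
        omega
      rw [add_assoc, Finset.sum_range_add, renewalBlock, indicator_of_mem hn, pathBlock, hd]
      rfl
    · rw [renewalBlock, indicator_of_notMem hn, add_zero]
      refine ih ⟨by omega, htR, fun m hm hmR => hmin m ?_ hmR⟩
      rcases hm.lt_or_eq with h | rfl
      · exact h
      · exact absurd hmR hn

lemma regenTime_succ_le {k m : ℕ} (hm : ω ∈ renewalSet Γ m) (hk : regenTime Γ k ω < m) :
    regenTime Γ (k + 1) ω ≤ m := by
  cases m with
  | zero => simp at hk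
  | succ m => exact sInf_le ⟨m + 1, rfl, hk, hm⟩

variable (hinf : ∀ i, ∃ k, Γ (i + k) ω = true)
include hinf

lemma exists_regenTime_succ {k : ℕ} (hk : regenTime Γ k ω ≠ ⊤) :
    ∃ m : ℕ, regenTime Γ (k + 1) ω = m ∧ regenTime Γ k ω < m ∧ ω ∈ renewalSet Γ m := by
  obtain ⟨a, ha⟩ := ENat.ne_top_iff_exists.1 hk
  obtain ⟨j, hj⟩ := hinf a
  have hne : {t : ℕ∞ | ∃ m : ℕ, t = m ∧ regenTime Γ k ω < m ∧ Γ (m - 1) ω = true}.Nonempty :=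
    ⟨((a + j + 1 : ℕ) : ℕ∞), a + j + 1, rfl, by rw [← ha]; exact_mod_cast (by omega), hj⟩
  obtain ⟨m, h1, h2, h3⟩ := csInf_mem hne
  refine ⟨m, h1, h2, ?_⟩
  cases m with
  | zero => exact mem_univ ω
  | succ m => exact h3

lemma exists_regenTime_eq (k : ℕ) :
    ∃ m : ℕ, regenTime Γ k ω = m ∧ ω ∈ renewalSet Γ m ∧ k ≤ m := by
  induction k with
  | zero => exact ⟨0, rfl, mem_univ ω, le_rfl⟩
  | succ k ih =>
    obtain ⟨a, ha, -, hka⟩ := ih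
    obtain ⟨m, h1, h2, h3⟩ := exists_regenTime_succ hinf (k := k) (by simp [ha])
    refine ⟨m, h1, h3, ?_⟩
    rw [ha] at h2
    have : a < m := by exact_mod_cast h2
    omega

lemma exists_stopTime_eq (n : ℕ) : ∃ t : ℕ, stopTime Γ n ω = t ∧ IsFirstRenewal Γ ω n t := by
  obtain ⟨t, ht, htR, -⟩ := exists_regenTime_eq hinf (stopIndex Γ n ω)
  have hne : {r : ℕ | (n : ℕ∞) ≤ regenTime Γ r ω}.Nonempty := by
    obtain ⟨m, hm, -, hnm⟩ := exists_regenTime_eq hinf n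
    refine ⟨n, ?_⟩
    change (n : ℕ∞) ≤ regenTime Γ n ω
    rw [hm]
    exact_mod_cast hnm
  have hmem : (n : ℕ∞) ≤ regenTime Γ (stopIndex Γ n ω) ω := Nat.sInf_mem hne
  refine ⟨t, ht, ?_, htR, fun m hnm hmR => ?_⟩
  · rw [ht] at hmem
    exact_mod_cast hmem
  · rcases hR : stopIndex Γ n ω with _ | r
    · rw [hR] at ht
      have : t = 0 := Nat.cast_injective (R := ℕ∞) ht.symm
      omega
    -- By minimality of `R(n) = r + 1`, `T_r < n ≤ m`, so `m` is a candidate in the definition of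
    -- `T_{r+1}`.
    · have hr : ¬ (n : ℕ∞) ≤ regenTime Γ r ω := fun h => by
        have : stopIndex Γ n ω ≤ r := Nat.sInf_le h
        omega
      have hlt : regenTime Γ r ω < m := (not_le.1 hr).trans_le (by exact_mod_cast hnm)
      have := regenTime_succ_le hmR hlt
      rw [← hR, ht] at this
      exact_mod_cast this

lemma sum_blockSum (X : ℕ → Ω → 𝒳) (g : 𝒳 → ℝ) (r : ℕ) :
    ∑ k ∈ Finset.Icc 1 r, blockSum X Γ g k ω =
      ∑ l ∈ Finset.range (regenTime Γ r ω).toNat, g (X l ω) := by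
  induction r with
  | zero => simp [regenTime]
  | succ r ih =>
    obtain ⟨a, ha, -⟩ := exists_regenTime_eq hinf r
    obtain ⟨m, h1, h2, -⟩ := exists_regenTime_succ hinf (k := r) (by simp [ha])
    have ham : a ≤ m := by
      rw [ha] at h2
      exact_mod_cast h2.le
    rw [Finset.sum_Icc_succ_top (by omega), ih, blockSum, Nat.add_sub_cancel, ha, h1]
    exact Finset.sum_range_add_sum_Ico (fun l => g (X l ω)) ham

lemma isFirstRenewal_regenTime_one :
    ∃ t : ℕ, regenTime Γ 1 ω = t ∧ IsFirstRenewal Γ ω 1 t := by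
  obtain ⟨t, ht, htR, h1⟩ := exists_regenTime_eq hinf 1
  refine ⟨t, ht, h1, htR, fun m hm hmR => ?_⟩
  have : regenTime Γ (0 + 1) ω ≤ m := regenTime_succ_le hmR (by
    change (0 : ℕ∞) < m
    exact_mod_cast hm)
  rw [zero_add, ht] at this
  exact_mod_cast this

lemma blockSum_one (X : ℕ → Ω → 𝒳) (g : 𝒳 → ℝ) :
    blockSum X Γ g 1 ω = pathBlock g (pathFrom X Γ 0 ω) := by
  obtain ⟨t, ht, hfirst⟩ := isFirstRenewal_regenTime_one hinf
  have h1 := sum_range_eq_sum_renewalBlock X g hfirst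
  have h2 := sum_blockSum hinf X g 1
  rw [ht, ENat.toNat_natCast, h1] at h2
  simpa [renewalBlock, renewalSet] using h2

lemma exists_blockLength_one :
    ∃ t : ℕ, blockLength Γ 1 ω = t ∧ ∀ l, ω ∈ noRegen Γ 0 l ↔ l < t := by
  obtain ⟨t, ht, h1, htR, hmin⟩ := isFirstRenewal_regenTime_one hinf
  refine ⟨t, ?_, fun l => ⟨fun hl => ?_, fun hl j hj => ?_⟩⟩
  · rw [blockLength, ht]
    simp [regenTime]
  · by_contra hlt
    exact notMem_noRegen_of_mem_renewalSet htR h1 (by omega) hl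
  · by_contra h
    have := hmin (j + 1) (by omega) (by simpa [renewalSet] using h)
    omega

/-- The estimation error is the sum of the centred blocks that start before time `n`, divided by
the time at which the last of these ends. -/
lemma seqRegenEstimator_sub (X : ℕ → Ω → 𝒳) (f : 𝒳 → ℝ) (θ : ℝ) {n : ℕ} (hn : 1 ≤ n) :
    seqRegenEstimator X Γ f n ω - θ =
      (∑ i ∈ Finset.range n, renewalBlock X Γ (fun x => f x - θ) i ω) /
        ∑ i ∈ Finset.range n, renewalBlock X Γ (fun _ => 1) i ω ∧
    (n : ℝ) ≤ ∑ i ∈ Finset.range n, renewalBlock X Γ (fun _ => 1) i ω := by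
  obtain ⟨t, ht, hfirst⟩ := exists_stopTime_eq hinf n
  have h1 : ∑ i ∈ Finset.range n, renewalBlock X Γ (fun _ => 1) i ω = t := by
    rw [← sum_range_eq_sum_renewalBlock X (fun _ => (1 : ℝ)) hfirst]
    simp
  have hnt : (n : ℝ) ≤ t := by exact_mod_cast hfirst.1
  have ht0 : (t : ℝ) ≠ 0 := by
    have : (1 : ℝ) ≤ n := by exact_mod_cast hn
    linarith
  rw [h1]
  refine ⟨?_, hnt⟩
  have ht' : regenTime Γ (stopIndex Γ n ω) ω = t := ht
  rw [← sum_range_eq_sum_renewalBlock X _ hfirst, seqRegenEstimator, sum_blockSum hinf, ht', ht,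
    ENat.toNat_natCast, Finset.sum_sub_distrib]
  simp only [Finset.sum_const, Finset.card_range, nsmul_eq_mul]
  field_simp

end Pathwise

/-! ### Block length moments and the overshoot constant -/

section Moments

variable {Ω 𝒳 : Type*} [MeasurableSpace Ω] [MeasurableSpace 𝒳] {P : Kernel 𝒳 𝒳}
  {ν : Measure 𝒳} {J : Set 𝒳} {β : ℝ} {μ : Measure Ω} {X : ℕ → Ω → 𝒳} {Γ : ℕ → Ω → Bool}

lemma sum_range_odd (t : ℕ) : ∑ k ∈ Finset.range t, (2 * (k : ℝ≥0∞) + 1) = (t : ℝ≥0∞) ^ 2 := by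
  induction t with
  | zero => simp
  | succ t ih =>
    rw [Finset.sum_range_succ, ih]
    push_cast
    ring

namespace IsSplitChain

variable (hc : IsSplitChain P ν J β μ X Γ)
  (hinf : ∀ᵐ ω ∂μ, ∀ i, ∃ k, Γ (i + k) ω = true)
include hc hinf

/-- The tail-sum formula for moments: the weights are the increments of `t ^ p`, namely `1` for `p =
1` and `2 k + 1` for `p = 2`. -/
lemma lintegral_blockLength {p : ℕ} {w : ℕ → ℝ≥0∞}
    (hw : ∀ t : ℕ, ∑ k ∈ Finset.range t, w k = (t : ℝ≥0∞) ^ p) :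
    blockMoment μ Γ p = ∑' k, w k * μ (noRegen Γ 0 k) := by
  have h1 : ∀ᵐ ω ∂μ, ((blockLength Γ 1 ω : ℕ∞) : ℝ≥0∞) ^ p =
      ∑' k, (noRegen Γ 0 k).indicator (fun _ => w k) ω := by
    filter_upwards [hinf] with ω hω
    obtain ⟨t, ht, hlt⟩ := exists_blockLength_one hω
    rw [ht, ENat.toENNReal_coe, ← hw t, tsum_eq_sum (s := Finset.range t)]
    · refine Finset.sum_congr rfl fun k hk => ?_
      rw [indicator_of_mem ((hlt k).2 (Finset.mem_range.1 hk))]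
    · intro k hk
      exact indicator_of_notMem (fun h => hk (Finset.mem_range.2 ((hlt k).1 h))) _
  rw [blockMoment, lintegral_congr_ae h1, lintegral_tsum fun k =>
    (measurable_const.indicator (hc.measurableSet_noRegen 0 k)).aemeasurable]
  exact tsum_congr fun k => lintegral_indicator_const (hc.measurableSet_noRegen 0 k) _

variable [IsProbabilityMeasure μ]

/-- Lorden's inequality for the block lengths. -/
theorem blockMoment_mul_sum_renewalSet_le (hJ : MeasurableSet J)
    (hτ : blockMoment μ Γ 2 < ∞) {n : ℕ} (hn : 1 ≤ n) :
    1 ≤ (blockMoment μ Γ 1).toReal ∧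
    (blockMoment μ Γ 1).toReal * ∑ i ∈ Finset.range n, μ.real (renewalSet Γ i) ≤
      n + overshootConst μ Γ := by
  have hm1 : blockMoment μ Γ 1 = ∑' k, 1 * μ (noRegen Γ 0 k) :=
    hc.lintegral_blockLength hinf fun t => by simp
  have hm2 : blockMoment μ Γ 2 = ∑' k : ℕ, (2 * (k : ℝ≥0∞) + 1) * μ (noRegen Γ 0 k) :=
    hc.lintegral_blockLength hinf sum_range_odd
  set q : ℕ → ℝ := fun k => μ.real (noRegen Γ 0 k) with hq
  have hterm : ∀ k : ℕ, ((2 * (k : ℝ≥0∞) + 1) * μ (noRegen Γ 0 k)).toReal =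
      (2 * (k : ℝ) + 1) * q k := fun k => by
    rw [ENNReal.toReal_mul, ENNReal.toReal_add (by finiteness) (by finiteness)]
    simp [hq, measureReal_def]
  have hsum2 : Summable fun k : ℕ => (2 * (k : ℝ) + 1) * q k := by
    have := ENNReal.summable_toReal (hm2 ▸ hτ.ne)
    simpa only [hterm] using this
  have hq0 : ∀ k, 0 ≤ q k := fun k => measureReal_nonneg
  have hsum : Summable q := Summable.of_nonneg_of_le hq0 (fun k => by
    have : 0 ≤ (k : ℝ) * q k := mul_nonneg k.cast_nonneg (hq0 k)
    linarith) hsum2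
  have hsum1 : Summable fun k : ℕ => (k : ℝ) * q k :=
    Summable.of_nonneg_of_le (fun k => mul_nonneg k.cast_nonneg (hq0 k)) (fun k => by
      have : 0 ≤ (k : ℝ) * q k := mul_nonneg k.cast_nonneg (hq0 k)
      linarith [hq0 k]) hsum2
  have hr1 : (blockMoment μ Γ 1).toReal = ∑' k, q k := by
    rw [hm1, ENNReal.tsum_toReal_eq (by finiteness)]
    simp [hq, measureReal_def]
  have hr2 : (blockMoment μ Γ 2).toReal = 2 * (∑' k : ℕ, (k : ℝ) * q k) + ∑' k, q k := by
    rw [hm2, ENNReal.tsum_toReal_eq (by finiteness), ← tsum_mul_left,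
      ← (hsum1.mul_left 2).tsum_add hsum]
    refine tsum_congr fun k => ?_
    rw [hterm]
    ring
  have hq1 : q 0 = 1 := by
    have : noRegen Γ 0 0 = univ := eq_univ_of_forall fun ω j hj => by omega
    simp [hq, this]
  have hge : 1 ≤ ∑' k, q k := hq1 ▸ hsum.le_tsum 0 fun j _ => hq0 j
  refine ⟨hr1 ▸ hge, ?_⟩
  -- Lorden's inequality at `t = n - 1`, whose partial sum has `n` terms. Since `E τ₁² = 2 ∑ k q k +
  -- ∑ q k`, its constant `2 ∑ k q k / ∑ q k` is `n₀`.
  have hl := renewal_lorden (u := fun i => μ.real (renewalSet Γ i)) (q := q)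
    (by simp [renewalSet]) (fun _ => measureReal_nonneg) hq0
    (fun i j hij => measureReal_mono (noRegen_antitone Γ 0 hij)) (hc.seqConv_renewal hJ)
    (hc.sum_real_renewalSet_le hJ) hsum hsum1 (n - 1)
  rw [Nat.sub_add_cancel hn, Nat.cast_sub hn] at hl
  rw [overshootConst, hr2, hr1, add_div, div_self (by linarith)]
  push_cast at hl
  linarith

end IsSplitChain
end Moments

/-! ### The mean square error bound -/

theorem corollary1 {𝒳 : Type*} [TopologicalSpace 𝒳] [PolishSpace 𝒳] [MeasurableSpace 𝒳]
    [BorelSpace 𝒳] {Ω : Type*} [MeasurableSpace Ω]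
    (π : Measure 𝒳) [IsProbabilityMeasure π]
    (P : Kernel 𝒳 𝒳) [IsMarkovKernel P]
    (hstat : Kernel.Invariant P π) (hirr : Kernel.IsIrreducible π P)
    (ν : Measure 𝒳) [IsProbabilityMeasure ν] (J : Set 𝒳) (β : ℝ)
    (hsmall : SmallSetCondition P π ν J β)
    (μ : Measure Ω) [IsProbabilityMeasure μ]
    (X : ℕ → Ω → 𝒳) (Γ : ℕ → Ω → Bool)
    (hchain : IsSplitChain P ν J β μ X Γ)
    (f : 𝒳 → ℝ) (hf : Measurable f) (hfπ : Integrable f π)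
    (hΞ : Integrable (fun ω => (blockSum X Γ (centred π f) 1 ω) ^ 2) μ)
    (hτ : blockMoment μ Γ 2 < ∞)
    (n : ℕ) (hn : 1 ≤ n) :
    (∀ᵐ ω ∂μ, stopTime Γ n ω ≠ ⊤) ∧
    Integrable (fun ω => (seqRegenEstimator X Γ f n ω - ∫ x, f x ∂π) ^ 2) μ ∧
    ∫ ω, (seqRegenEstimator X Γ f n ω - ∫ x, f x ∂π) ^ 2 ∂μ ≤
      asymptoticVariance π μ X Γ f / n * (1 + overshootConst μ Γ / n) := by
  have hJ := hsmall.measurableSet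
  have hinf := hchain.ae_infinitely_many_regen hJ
    (hchain.tsum_noRegen_ne_top hstat hirr hsmall)
  set θ := ∫ x, f x ∂π with hθ
  have hg : Measurable (centred π f) := hf.sub measurable_const
  have hgπ : Integrable (centred π f) π := hfπ.sub (integrable_const _)
  have hg0 : ∫ x, centred π f x ∂π = 0 := by
    simp only [centred]
    rw [integral_sub hfπ (integrable_const _)]
    simp
  have h0 := hchain.integral_pathBlock_eq_zero hstat hirr hsmall hg hgπ hg0
  have hblock : (fun ω => (blockSum X Γ (centred π f) 1 ω) ^ 2) =ᵐ[μ]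
      fun ω => pathBlock (centred π f) (pathFrom X Γ 0 ω) ^ 2 := by
    filter_upwards [hinf] with ω hω
    rw [blockSum_one hω]
  have h2 := hΞ.congr hblock
  set S : Ω → ℝ := fun ω => ∑ i ∈ Finset.range n, renewalBlock X Γ (centred π f) i ω with hS
  set T : Ω → ℝ := fun ω => ∑ i ∈ Finset.range n, renewalBlock X Γ (fun _ => 1) i ω with hT
  have hSL : MemLp S 2 μ := memLp_finsetSum _ fun i _ => hchain.memLp_renewalBlock hJ hg h2 i
  have hSm : Measurable S := Finset.measurable_sum _ fun i _ => hchain.measurable_renewalBlock hg i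
  have hTm : Measurable T := Finset.measurable_sum _ fun i _ =>
    hchain.measurable_renewalBlock measurable_const i
  have hn0 : (0 : ℝ) < n := by exact_mod_cast hn
  have herr : (fun ω => (seqRegenEstimator X Γ f n ω - θ) ^ 2) =ᵐ[μ]
      fun ω => (S ω / T ω) ^ 2 := by
    filter_upwards [hinf] with ω hω
    rw [(seqRegenEstimator_sub hω X f θ hn).1]
    rfl
  -- The random denominator is replaced by its lower bound `n`, leaving only the second moment of
  -- `S`.
  have hbound : ∀ᵐ ω ∂μ, (S ω / T ω) ^ 2 ≤ S ω ^ 2 / (n : ℝ) ^ 2 := by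
    filter_upwards [hinf] with ω hω
    have hT' : (n : ℝ) ≤ T ω := (seqRegenEstimator_sub hω X f θ hn).2
    rw [div_pow]
    gcongr
  have hSint : Integrable (fun ω => S ω ^ 2 / (n : ℝ) ^ 2) μ := hSL.integrable_sq.div_const _
  have hint : Integrable (fun ω => (S ω / T ω) ^ 2) μ := by
    refine hSint.mono' ((hSm.div hTm).pow_const 2).aestronglyMeasurable ?_
    filter_upwards [hbound] with ω hω
    rwa [Real.norm_of_nonneg (sq_nonneg _)]
  refine ⟨?_, hint.congr herr.symm, ?_⟩
  · filter_upwards [hinf] with ω hω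
    obtain ⟨t, ht, -⟩ := exists_stopTime_eq hω n
    simp [ht]
  · obtain ⟨hm1, hlor⟩ := hchain.blockMoment_mul_sum_renewalSet_le hinf hJ hτ hn
    rw [integral_congr_ae herr, asymptoticVariance, integral_congr_ae hblock]
    refine (integral_mono_ae hint hSint hbound).trans ?_
    rw [integral_div, hchain.integral_sum_renewalBlock_sq hJ hg h0 h2 n]
    set V := ∫ ω, pathBlock (centred π f) (pathFrom X Γ 0 ω) ^ 2 ∂μ with hV
    have hV0 : 0 ≤ V := integral_nonneg fun ω => sq_nonneg _
    set m := (blockMoment μ Γ 1).toReal with hm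
    set U := ∑ i ∈ Finset.range n, μ.real (renewalSet Γ i) with hU
    have hm0 : 0 < m := by linarith
    have hUle : U ≤ (n + overshootConst μ Γ) / m := by
      rw [le_div_iff₀ hm0]
      linarith
    calc U * V / (n : ℝ) ^ 2 ≤ (n + overshootConst μ Γ) / m * V / (n : ℝ) ^ 2 := by gcongr
      _ = V / m / n * (1 + overshootConst μ Γ / n) := by
          field_simp
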